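/- Let $\tfrac13<a<1$. For $b\in\mathbb R$ and $z\in\mathbb C$ let $E_{a,b}(z)=\sum_{n\ge0}z^n/\Gamma(an+b)$ (with $1/\Gamma=0$ at the poles of $\Gamma$); these series converge for all $z$, and $E_a=E_{a,1}$. For $x>0$ and every $M\in\mathbb N$, $$E_a(-x)=-\sum_{k=1}^{M}\frac{(-x)^{-k}}{\Gamma(1-ak)}+R_M(a;-x),\qquad R_M(a;z)=z^{-M}E_{a,1-aM}(z).$$ Put $X=x^{1/a}$ and let $M$ be an optimal truncation index, that is, $aM=X+\nu$ with $|\nu|\le N$, where $N$ is fixed. Put $\omega=\omega(\pi)=\pi(1-a)/a$, and let $c=c(\pi)$ be the value at $\omega(\pi)$ of the root of $\tfrac12c^2=1+i\omega-e^{i\omega}$ with, for $\omega\to0$, $$c=\omega+\tfrac16 i\omega^2-\tfrac1{36}\omega^3-\tfrac1{270}i\omega^4+\tfrac1{2592}\omega^5+O(\omega^6)$$ (continued continuously along $0<\omega<2\pi$). Let $t=t(u)>0$ be defined for $u\in\mathbb R$ by $\tfrac12u^2=t-\log t-1$ with $u$ of the sign of $t-1$; put $$f(u)=\frac{t^{a+\nu-1}}{t^a-e^{ia\omega}}\,\frac{dt}{du},\qquad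 A=\frac{e^{i\nu\omega}}{a},\qquad u_0=ic,$$ and define $B_r(\pi)=B_r(\pi;a,\nu)$ by the convergent expansion, for all real $u$ near $0$, $$f(u)=A\Bigl\{\frac1{u-u_0}+\sum_{r\ge0}B_r(\pi)u^r\Bigr\}.$$ Then, as $x\to+\infty$, $R_M(a;-x)=O(e^{-X})$, and for every integer $K\ge0$ $$R_M(a;-x)=\frac2a\,\Re\Bigl\{\tfrac12\exp(Xe^{\pi i/a})\,\mathrm{erfc}\bigl(c\sqrt{X/2}\bigr)-\frac{i\,e^{-X-i\omega X}}{\sqrt{2\pi X}}\sum_{k=0}^{K-1}B_{2k}(\pi)\,(\tfrac12)_k\,(X/2)^{-k}\Bigr\}+O\bigl(e^{-X}X^{-K-1/2}\bigr),$$ where $(\tfrac12)_k$ is the Pochhammer symbol and the $O$-constants depend only on $a$, $N$ and $K$. -/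

import Mathlib

open Filter Topology Asymptotics

namespace MittagLefflerExpansion

noncomputable section

/-- The `n`-th term `z ^ n / Γ(a n + b)` of the two-parameter Mittag-Leffler series.
At a pole of `Γ` Mathlib sets `Γ = 0`, so the quotient is `0`, the value of the entire
function `1 / Γ` there. -/
def mlTerm (a b : ℝ) (z : ℂ) (n : ℕ) : ℂ :=
  z ^ n / Complex.Gamma ((a * n + b : ℝ) : ℂ)

/-- The two-parameter Mittag-Leffler function `E_{a,b}(z) = ∑ z ^ n / Γ(a n + b)`. -/
def mittagLeffler₂ (a b : ℝ) (z : ℂ) : ℂ := ∑' n : ℕ, mlTerm a b z n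

/-- The Mittag-Leffler function `E_a(z) = ∑ z ^ n / Γ(a n + 1)`. -/
def mittagLeffler (a : ℝ) (z : ℂ) : ℂ := mittagLeffler₂ a 1 z

/-- The remainder `R_M(a; z) = z ^ (-M) E_{a, 1 - a M}(z)`. -/
def remainder (M : ℕ) (a : ℝ) (z : ℂ) : ℂ :=
  z ^ (-(M : ℤ)) * mittagLeffler₂ a (1 - a * M) z

/-- The complementary error function `erfc z = 1 - (2 / √π) ∫_0^z exp (-s²) ds` on `ℂ`,
the integral being taken along the segment from `0` to `z`. -/
def erfc (z : ℂ) : ℂ :=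
  1 - (2 / (Real.sqrt Real.pi : ℂ)) * (z * ∫ s in (0 : ℝ)..1, Complex.exp (-(z * s) ^ 2))

/-- `ω(π) = π (1 - a) / a`. -/
def omega (a : ℝ) : ℝ := Real.pi * (1 - a) / a

/-- The root `c` of `c² / 2 = 1 + i ω - exp (i ω)` with `c = ω + O(ω²)` at `ω = 0`.
For `0 < |ω| < 2π` the radicand below has positive real part `2 (1 - cos ω) / ω²`
and it tends to `1` as `ω → 0`, so the principal root selects this branch. -/
def cRoot (ω : ℝ) : ℂ :=
  ω * (2 * (1 + Complex.I * ω - Complex.exp (Complex.I * ω)) / (ω : ℂ) ^ 2) ^ (1 / 2 : ℂ)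

/-- The real variable `u` with `u² / 2 = t - log t - 1` and the sign of `t - 1`, for `t > 0`. -/
def saddleU (t : ℝ) : ℝ := SignType.sign (t - 1) * Real.sqrt (2 * (t - Real.log t - 1))

/-- The inverse change of variable `u ↦ t`, from `ℝ` to `(0, ∞)`; the saddle `t = 1` is `u = 0`. -/
def saddleT : ℝ → ℝ := Function.invFunOn saddleU (Set.Ioi 0)

theorem saddleU_of_ge {t : ℝ} (ht : 1 ≤ t) :
    saddleU t = Real.sqrt (2 * (t - Real.log t - 1)) := by
  rcases ht.eq_or_lt with rfl | h
  · simp [saddleU]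
  · simp [saddleU, sign_pos (sub_pos.2 h)]

theorem saddleU_of_le {t : ℝ} (ht : t ≤ 1) :
    saddleU t = -Real.sqrt (2 * (t - Real.log t - 1)) := by
  rcases ht.eq_or_lt with rfl | h
  · simp [saddleU]
  · simp [saddleU, sign_neg (sub_neg.2 h)]

theorem saddleU_surjOn (u : ℝ) : ∃ t ∈ Set.Ioi (0 : ℝ), saddleU t = u := by
  have hc : ∀ s : Set ℝ, (∀ t ∈ s, t ≠ 0) →
      ContinuousOn (fun t : ℝ => Real.sqrt (2 * (t - Real.log t - 1))) s := by
    intro s hs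
    fun_prop (disch := assumption)
  rcases le_total 0 u with hu | hu
  · have h1 : (1 : ℝ) ≤ u ^ 2 + 4 := by nlinarith
    have hlog : Real.log (u ^ 2 + 4) ≤ (u ^ 2 + 4) / 2 := by
      have h2 := Real.log_le_sub_one_of_pos (show (0 : ℝ) < (u ^ 2 + 4) / 2 by positivity)
      have h3 := Real.log_two_lt_d9
      rw [Real.log_div (by positivity) (by norm_num)] at h2
      linarith
    have := intermediate_value_Icc h1 (hc _ (fun t ht => by have := ht.1; linarith))
    obtain ⟨t, ht, h⟩ := this (show u ∈ _ by
      refine ⟨by simpa using hu, Real.le_sqrt_of_sq_le ?_⟩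
      linarith)
    exact ⟨t, by have := ht.1; simp only [Set.mem_Ioi]; linarith,
      by rw [saddleU_of_ge ht.1]; exact h⟩
  · have hp : 0 < Real.exp (-(u ^ 2 + 1)) := Real.exp_pos _
    have h1 : Real.exp (-(u ^ 2 + 1)) ≤ 1 := Real.exp_le_one_iff.2 (by nlinarith)
    have := intermediate_value_Icc' h1 (hc _ (fun t ht => by have := ht.1; linarith))
    obtain ⟨t, ht, h⟩ := this (show -u ∈ _ by
      refine ⟨by simpa using hu, Real.le_sqrt_of_sq_le ?_⟩
      simp only [Real.log_exp]
      nlinarith)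
    exact ⟨t, by have := ht.1; simp only [Set.mem_Ioi]; linarith,
      by rw [saddleU_of_le ht.2]; simp only at h; linarith⟩

theorem saddleT_pos (u : ℝ) : 0 < saddleT u := Function.invFunOn_mem (saddleU_surjOn u)

theorem saddleU_saddleT (u : ℝ) : saddleU (saddleT u) = u :=
  Function.invFunOn_eq (saddleU_surjOn u)

/-- The change of variable satisfies `u² / 2 = t - log t - 1`. -/
theorem saddleT_spec (u : ℝ) : u ^ 2 / 2 = saddleT u - Real.log (saddleT u) - 1 := by
  have h0 : 0 ≤ 2 * (saddleT u - Real.log (saddleT u) - 1) := by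
    have := Real.log_le_sub_one_of_pos (saddleT_pos u)
    linarith
  have h : u ^ 2 = 2 * (saddleT u - Real.log (saddleT u) - 1) := by
    nth_rewrite 1 [← saddleU_saddleT u]
    rcases le_total 1 (saddleT u) with h | h
    · rw [saddleU_of_ge h, Real.sq_sqrt h0]
    · rw [saddleU_of_le h, neg_sq, Real.sq_sqrt h0]
  linarith

/-- The function `f(u) = t ^ (a + ν - 1) / (t ^ a - t₀ ^ a) * dt/du` with `t₀ = exp (i ω)`,
`ω = π (1 - a) / a`, and `t₀ ^ a = exp (i a ω)`. -/
def f (a ν u : ℝ) : ℂ :=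
  ((saddleT u ^ (a + ν - 1) : ℝ) : ℂ)
    / (((saddleT u ^ a : ℝ) : ℂ) - Complex.exp (Complex.I * a * omega a))
    * ((deriv saddleT u : ℝ) : ℂ)

/-- The location `u₀ = i c` of the pole of `f`. -/
def poleU (a : ℝ) : ℂ := Complex.I * cRoot (omega a)

/-- The residue `A = exp (i ν ω) / a` of `f` at `u₀`. -/
def residueA (a ν : ℝ) : ℂ := Complex.exp (Complex.I * ν * omega a) / a

/-- The function `g` in `f(u) = A (1 / (u - u₀) + g(u))`. -/
def g (a ν u : ℝ) : ℂ := f a ν u / residueA a ν - 1 / ((u : ℂ) - poleU a)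

/-- The Maclaurin coefficients `B_r(π)` (depending on `a` and `ν`) of `g`. -/
def coeffB (a ν : ℝ) (r : ℕ) : ℂ := iteratedDeriv r (g a ν) 0 / (r.factorial : ℂ)

/-- The expression in braces in the expansion, with the sum truncated to the terms `k < K`:
`½ exp (X e^{π i / a}) erfc (c √(X / 2))
  - i e^{-X - i ω X} / √(2 π X) * ∑_{k < K} B_{2k} (½)_k (X / 2) ^ (-k)`. -/
def expansion (a ν X : ℝ) (K : ℕ) : ℂ :=
  Complex.exp (X * Complex.exp (Real.pi * Complex.I / a)) / 2
      * erfc (cRoot (omega a) * (Real.sqrt (X / 2) : ℝ))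
    - Complex.I * Complex.exp (-X - Complex.I * omega a * X)
        / ((Real.sqrt (2 * Real.pi * X) : ℝ) : ℂ)
      * ∑ k ∈ Finset.range K,
          coeffB a ν (2 * k) * (ascPochhammer ℂ k).eval (1 / 2) * ((X : ℂ) / 2) ^ (-(k : ℤ))

end

end MittagLefflerExpansion

/-!
The remainder has an exact representation as a Gaussian integral, from which both estimates follow.

By Hankel's formula `hankel_kernel`, each `1 / Γ(a n + b)` is a contour integral of
`exp s * s ^ (-(a n + b))`. Summing the geometric series under the integral sign (`hasSum_mlTerm`)
proves that the Mittag-Leffler series converges and expresses its sum by an integral. For `z = -x` and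
`a < 1` the integrand has no pole with `|arg s| ≤ π`, so the contour collapses onto the negative axis,
and the remainder becomes the imaginary part of a real integral (`remainder_eq_im_integral`).

Put `X = x ^ (1 / a)` and `a M = X + ν`, and substitute `s = X t` and then `t = t(u)` with
`u² / 2 = t - log t - 1`. This turns the remainder into
`exp (-X) / π` times the imaginary part of `exp (-i ω (X + ν)) ∫ exp (-X u² / 2) f(u) du`
(`remainder_eq_im`). Since `f` grows at most like a fixed Gaussian, the remainder is `O(exp (-X))`.

Now write `f = A (1 / (u - i c) + g)`. Because `0 < ω < 2 π`, the number `c` has positive real part, and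
the pole contributes exactly the `erfc` term (`integral_gaussian_div_sub_scaled`), as
`c² / 2 = 1 + i ω - exp (i ω)`. The part `g` contributes the series, by Watson's lemma
(`norm_integral_gaussian_sub_le`). Uniformity in `ν` holds because `t(u)` extends holomorphically to a
neighbourhood of `u = 0` that is independent of `ν`, where Cauchy's estimates bound the coefficients
(`exists_hasSum_coeffB`), while `norm_f_le` bounds the growth of `f`.

Throughout, `s = exp v` is used as the variable of integration: the contour becomes the boundary of a
half strip, powers of `s` become entire, and Cauchy's theorem is needed for rectangles only.
-/

namespace MittagLefflerExpansion

open MeasureTheory Set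

noncomputable section

/-! ### Hankel's formula for the reciprocal Gamma function -/

/-- The Hankel integral of `F`, in the logarithmic variable `v = log s`: the integral over the
boundary of the half strip `re v > L`, `|im v| < π`, run through from `+∞ - π i` to `+∞ + π i`.
In the `s`-plane this is the loop from `-∞` along the lower side of the negative axis, around the
circle `|s| = exp L`, and back to `-∞` along the upper side. -/
def hankel (F : ℂ → ℂ) (L : ℝ) : ℂ :=
  (∫ r in Ioi L, F (r + Real.pi * Complex.I)) - (∫ r in Ioi L, F (r - Real.pi * Complex.I))
    + Complex.I * ∫ θ in (-Real.pi)..Real.pi, F (L + θ * Complex.I)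

/-- The Hankel integral does not depend on the radius: Cauchy's theorem on a rectangle. -/
theorem hankel_eq_of_le {F : ℂ → ℂ} {L L' : ℝ} (hL : L' ≤ L)
    (hF : ∀ v : ℂ, |v.im| ≤ Real.pi → DifferentiableAt ℂ F v)
    (ht : IntegrableOn (fun r : ℝ => F (r + Real.pi * Complex.I)) (Ioi L'))
    (hb : IntegrableOn (fun r : ℝ => F (r - Real.pi * Complex.I)) (Ioi L')) :
    hankel F L = hankel F L' := by
  have hpi := Real.pi_pos
  have key := Complex.integral_boundary_rect_eq_zero_of_differentiableOn F
    (⟨L', -Real.pi⟩ : ℂ) (⟨L, Real.pi⟩ : ℂ) (by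
      intro v hv
      refine (hF v ?_).differentiableWithinAt
      have := hv.2
      simp only [mem_preimage] at this
      rw [uIcc_of_le (by linarith)] at this
      exact abs_le.2 this)
  simp only [Complex.ofReal_neg, neg_mul, smul_eq_mul, ← sub_eq_add_neg] at key
  have split : ∀ G : ℝ → ℂ, IntegrableOn G (Ioi L') →
      ∫ r in Ioi L', G r = (∫ r in L'..L, G r) + ∫ r in Ioi L, G r := by
    intro G hG
    rw [← intervalIntegral.integral_Ioi_sub_Ioi hG hL]
    ring
  rw [hankel, hankel, split _ ht, split _ hb]
  linear_combination key

/-- Collapsing the contour onto the cut: the Hankel integral is the integral of the jump across the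
negative axis, provided that the contribution of the small circle vanishes. -/
theorem hankel_eq_integral {F : ℂ → ℂ} (L : ℝ)
    (hF : ∀ v : ℂ, |v.im| ≤ Real.pi → DifferentiableAt ℂ F v)
    (ht : Integrable (fun r : ℝ => F (r + Real.pi * Complex.I)))
    (hb : Integrable (fun r : ℝ => F (r - Real.pi * Complex.I)))
    (hs : Tendsto (fun L : ℝ => ∫ θ in (-Real.pi)..Real.pi, F (L + θ * Complex.I)) atBot (𝓝 0)) :
    hankel F L = (∫ r : ℝ, F (r + Real.pi * Complex.I)) - ∫ r : ℝ, F (r - Real.pi * Complex.I) := by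
  have h1 := (aecover_Ioi (μ := volume) (tendsto_id (α := ℝ) (x := atBot))).integral_tendsto_of_countably_generated ht
  have h2 := (aecover_Ioi (μ := volume) (tendsto_id (α := ℝ) (x := atBot))).integral_tendsto_of_countably_generated hb
  have h3 : Tendsto (hankel F) atBot (𝓝 ((∫ r : ℝ, F (r + Real.pi * Complex.I))
      - (∫ r : ℝ, F (r - Real.pi * Complex.I)) + Complex.I * 0)) :=
    (h1.sub h2).add (hs.const_mul _)
  rw [mul_zero, add_zero] at h3
  refine tendsto_nhds_unique (tendsto_const_nhds.congr' ?_) h3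
  filter_upwards [eventually_le_atBot L] with L' hL'
  exact hankel_eq_of_le hL' hF ht.integrableOn hb.integrableOn

theorem tendsto_side {F : ℂ → ℂ} {e : ℝ → ℝ} {c : ℂ}
    (he : Tendsto e atBot (𝓝 0))
    (hc : ∀ L : ℝ,
      IntervalIntegrable (fun θ : ℝ => F (L + θ * Complex.I)) volume (-Real.pi) Real.pi)
    (h : ∀ᶠ L : ℝ in atBot, ∀ θ : ℝ, ‖F (L + θ * Complex.I) - c‖ ≤ e L) :
    Tendsto (fun L : ℝ => ∫ θ in (-Real.pi)..Real.pi, F (L + θ * Complex.I)) atBot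
      (𝓝 (2 * Real.pi * c)) := by
  rw [tendsto_iff_norm_sub_tendsto_zero]
  refine squeeze_zero' (Eventually.of_forall fun _ => norm_nonneg _) ?_
    (by simpa only [zero_mul] using he.mul_const |Real.pi - -Real.pi|)
  filter_upwards [h] with L hL
  have : (∫ θ in (-Real.pi)..Real.pi, F (L + θ * Complex.I)) - 2 * Real.pi * c
      = ∫ θ in (-Real.pi)..Real.pi, (F (L + θ * Complex.I) - c) := by
    rw [intervalIntegral.integral_sub (hc L) (by simp),
      intervalIntegral.integral_const, sub_neg_eq_add, Complex.real_smul]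
    push_cast
    ring
  rw [this]
  exact intervalIntegral.norm_integral_le_of_norm_le_const fun θ _ => hL θ

theorem integrable_exp_neg_exp {p : ℝ} (hp : 0 < p) :
    Integrable fun r : ℝ => Real.exp (-Real.exp r) * Real.exp (p * r) := by
  have h := (integrableOn_image_iff_integrableOn_abs_deriv_smul (s := univ) MeasurableSet.univ
    (fun x _ => (Real.hasDerivAt_exp x).hasDerivWithinAt) Real.exp_injective.injOn
    (fun x => Real.exp (-x) * x ^ (p - 1))).1 (by
      rw [image_univ, Real.range_exp]
      exact Real.GammaIntegral_convergent hp)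
  rw [integrableOn_univ] at h
  refine h.congr (Eventually.of_forall fun r => ?_)
  simp only [Real.abs_exp, smul_eq_mul, ← Real.exp_mul]
  rw [← Real.exp_add, ← Real.exp_add, ← Real.exp_add]
  ring_nf

/-- Euler's integral for `Γ(p)` in the logarithmic variable. -/
theorem integral_exp_neg_exp {p : ℝ} (hp : 0 < p) :
    ∫ r : ℝ, Real.exp (-Real.exp r) * Real.exp (p * r) = Real.Gamma p := by
  have h := integral_image_eq_integral_abs_deriv_smul (s := univ) MeasurableSet.univ
    (fun x _ => (Real.hasDerivAt_exp x).hasDerivWithinAt) Real.exp_injective.injOn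
    (fun x => Real.exp (-x) * x ^ (p - 1))
  rw [image_univ, Real.range_exp, setIntegral_univ] at h
  rw [Real.Gamma_eq_integral hp, h]
  congr 1 with r
  simp only [Real.abs_exp, smul_eq_mul, ← Real.exp_mul]
  rw [← Real.exp_add, ← Real.exp_add, ← Real.exp_add]
  ring_nf

theorem integrableOn_exp_neg_exp (p L : ℝ) :
    IntegrableOn (fun r : ℝ => Real.exp (-Real.exp r) * Real.exp (p * r)) (Ioi L) := by
  have h := ((integrable_exp_neg_exp (p := |p| + 1) (by positivity)).mul_const
    (Real.exp ((p - (|p| + 1)) * L))).integrableOn (s := Ioi L)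
  refine h.mono' (by fun_prop) ?_
  filter_upwards [ae_restrict_mem measurableSet_Ioi] with r hr
  rw [Real.norm_of_nonneg (by positivity), mul_assoc]
  gcongr
  rw [← Real.exp_add]
  gcongr
  have : 0 ≤ (|p| + 1 - p) * (r - L) :=
    mul_nonneg (by linarith [le_abs_self p]) (by linarith [mem_Ioi.1 hr])
  linarith

/-- The integrand `exp s * s ^ (-b) ds` of Hankel's formula for `1 / Γ(b)`, with `s = exp v`. -/
def hankelKernel (b : ℝ) (v : ℂ) : ℂ := Complex.exp (Complex.exp v + (1 - b) * v)

theorem differentiable_hankelKernel (b : ℝ) : Differentiable ℂ (hankelKernel b) := by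
  unfold hankelKernel; fun_prop

theorem exp_add_pi (r : ℝ) : Complex.exp (r + Real.pi * Complex.I) = -Real.exp r := by
  rw [Complex.exp_add, Complex.exp_pi_mul_I]; simp

theorem exp_sub_pi (r : ℝ) : Complex.exp (r - Real.pi * Complex.I) = -Real.exp r := by
  rw [Complex.exp_sub, Complex.exp_pi_mul_I]; simp [div_neg]

theorem hankelKernel_top (b r : ℝ) : hankelKernel b (r + Real.pi * Complex.I) =
    (Real.exp (-Real.exp r) * Real.exp ((1 - b) * r) : ℝ)
      * Complex.exp (Real.pi * (1 - b) * Complex.I) := by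
  rw [hankelKernel, exp_add_pi]
  push_cast
  rw [← Complex.exp_add, ← Complex.exp_add]
  ring_nf

theorem hankelKernel_bot (b r : ℝ) : hankelKernel b (r - Real.pi * Complex.I) =
    (Real.exp (-Real.exp r) * Real.exp ((1 - b) * r) : ℝ)
      * Complex.exp (-(Real.pi * (1 - b) * Complex.I)) := by
  rw [hankelKernel, exp_sub_pi]
  push_cast
  rw [← Complex.exp_add, ← Complex.exp_add]
  ring_nf

theorem integrableOn_hankelKernel_top (b L : ℝ) :
    IntegrableOn (fun r : ℝ => hankelKernel b (r + Real.pi * Complex.I)) (Ioi L) := by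
  simp only [hankelKernel_top]
  exact (integrableOn_exp_neg_exp _ _).ofReal.mul_const _

theorem integrableOn_hankelKernel_bot (b L : ℝ) :
    IntegrableOn (fun r : ℝ => hankelKernel b (r - Real.pi * Complex.I)) (Ioi L) := by
  simp only [hankelKernel_bot]
  exact (integrableOn_exp_neg_exp _ _).ofReal.mul_const _

theorem norm_hankelKernel_side_le (b L θ : ℝ) :
    ‖hankelKernel b (L + θ * Complex.I)‖ ≤ Real.exp (Real.exp L) * Real.exp ((1 - b) * L) := by
  rw [hankelKernel, Complex.exp_add, norm_mul]
  gcongr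
  · refine (Complex.norm_exp_le_exp_norm _).trans_eq ?_
    rw [Complex.norm_exp]; simp
  · rw [Complex.norm_exp]; simp

/-- For `b < 1` the contour collapses onto the cut, and the formula is Euler's reflection formula. -/
theorem hankel_kernel_of_lt_one {b : ℝ} (hb : b < 1) (L : ℝ) :
    hankel (hankelKernel b) L = 2 * Real.pi * Complex.I * (Complex.Gamma b)⁻¹ := by
  have hp : 0 < 1 - b := by linarith
  have hint := integrable_exp_neg_exp hp
  rw [hankel_eq_integral L (fun v _ => (differentiable_hankelKernel b) v)]
  · simp only [hankelKernel_top, hankelKernel_bot]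
    rw [integral_mul_const, integral_mul_const, integral_complex_ofReal, integral_exp_neg_exp hp,
      ← mul_sub]
    have h2 : Complex.exp (Real.pi * (1 - b) * Complex.I)
        - Complex.exp (-(Real.pi * (1 - b) * Complex.I))
        = 2 * Complex.I * Complex.sin (Real.pi * b) := by
      have : Complex.sin (Real.pi * b) = Complex.sin (Real.pi * (1 - b)) := by
        rw [← Complex.sin_pi_sub]; ring_nf
      rw [this, Complex.sin, ← neg_mul]
      linear_combination -(Complex.exp (-(Real.pi * (1 - b)) * Complex.I)
        - Complex.exp (Real.pi * (1 - b) * Complex.I)) * Complex.I_sq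
    rw [h2, ← Complex.Gamma_ofReal]
    have h3 := Complex.Gamma_mul_Gamma_one_sub b
    push_cast
    have h4 : Complex.Gamma (1 - b) ≠ 0 := by
      apply Complex.Gamma_ne_zero_of_re_pos; simpa using hb
    by_cases hs : Complex.sin (Real.pi * b) = 0
    · rw [hs, div_zero] at h3
      rw [hs, (mul_eq_zero.1 h3).resolve_right h4]; simp
    · have h5 : Complex.Gamma b ≠ 0 := by
        intro h; rw [h, zero_mul] at h3
        exact div_ne_zero (by exact_mod_cast Real.pi_ne_zero) hs h3.symm
      rw [eq_div_iff hs] at h3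
      rw [← div_eq_mul_inv, eq_div_iff h5]
      linear_combination 2 * Complex.I * h3
  · simp only [hankelKernel_top]; exact hint.ofReal.mul_const _
  · simp only [hankelKernel_bot]; exact hint.ofReal.mul_const _
  · have := tendsto_side (F := hankelKernel b) (c := 0)
      (e := fun L => Real.exp (Real.exp L) * Real.exp ((1 - b) * L)) ?_ ?_ ?_
    · simpa using this
    · have h1 : Tendsto (fun L : ℝ => Real.exp (Real.exp L)) atBot (𝓝 (Real.exp 0)) :=
        (Real.continuous_exp.tendsto 0).comp Real.tendsto_exp_atBot
      have h2 : Tendsto (fun L : ℝ => Real.exp ((1 - b) * L)) atBot (𝓝 0) :=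
        Real.tendsto_exp_atBot.comp (tendsto_id.const_mul_atBot hp)
      simpa using h1.mul h2
    · intro L
      exact ((differentiable_hankelKernel b).continuous.comp (by fun_prop)).intervalIntegrable _ _
    · refine Eventually.of_forall fun L θ => ?_
      rw [sub_zero]; exact norm_hankelKernel_side_le b L θ

/-- For `b = 1` the integrand is not integrable down to `-∞`, but its values on the two sides of the
cut are equal, and only the small circle contributes. -/
theorem hankel_kernel_one (L : ℝ) :
    hankel (hankelKernel 1) L = 2 * Real.pi * Complex.I := by
  have h0 : ∀ L, hankel (hankelKernel 1) L =
      Complex.I * ∫ θ in (-Real.pi)..Real.pi, hankelKernel 1 (L + θ * Complex.I) := by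
    intro L
    simp only [hankel, hankelKernel_top, hankelKernel_bot]
    simp
  have h3 : Tendsto (hankel (hankelKernel 1)) atBot (𝓝 (Complex.I * (2 * Real.pi * 1))) := by
    rw [funext h0]
    refine Tendsto.const_mul _ (tendsto_side (e := fun L => 2 * Real.exp L) ?_ ?_ ?_)
    · simpa using Real.tendsto_exp_atBot.const_mul 2
    · intro L
      exact ((differentiable_hankelKernel 1).continuous.comp (by fun_prop)).intervalIntegrable _ _
    · filter_upwards [eventually_le_atBot 0] with L hL θ
      have hn : ‖Complex.exp (L + θ * Complex.I)‖ = Real.exp L := by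
        rw [Complex.norm_exp]; simp
      have := Complex.norm_exp_sub_one_le (x := Complex.exp (L + θ * Complex.I))
        (by rw [hn]; exact Real.exp_le_one_iff.2 hL)
      rw [hn] at this
      simpa [hankelKernel] using this
  have h4 : hankel (hankelKernel 1) L = Complex.I * (2 * Real.pi * 1) := by
    refine tendsto_nhds_unique (tendsto_const_nhds.congr' ?_) h3
    filter_upwards [eventually_le_atBot L] with L' hL'
    exact hankel_eq_of_le hL' (fun v _ => differentiable_hankelKernel 1 v)
      (integrableOn_hankelKernel_top 1 L') (integrableOn_hankelKernel_bot 1 L')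
  rw [h4]; ring

/-- The recurrence dual to `Γ(b + 1) = b Γ(b)`: the difference of the two sides is the integral of the
derivative of `hankelKernel (b + 1)` along the contour. -/
theorem hankel_kernel_add_one (b L : ℝ) :
    hankel (hankelKernel b) L = b * hankel (hankelKernel (b + 1)) L := by
  have hd : ∀ v : ℂ, HasDerivAt (hankelKernel (b + 1))
      (hankelKernel b v - b * hankelKernel (b + 1) v) v := by
    intro v
    unfold hankelKernel
    have h1 : HasDerivAt (fun v => Complex.exp v + (1 - ((b + 1 : ℝ) : ℂ)) * v)
        (Complex.exp v + (1 - ((b + 1 : ℝ) : ℂ)) * 1) v :=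
      (Complex.hasDerivAt_exp v).add ((hasDerivAt_id v).const_mul _)
    refine h1.cexp.congr_deriv ?_
    have : Complex.exp v + (1 - (b : ℂ)) * v
        = (Complex.exp v + (1 - ((b + 1 : ℝ) : ℂ)) * v) + v := by push_cast; ring
    rw [this, Complex.exp_add _ v]
    push_cast
    ring
  have hc := fun b => (differentiable_hankelKernel b).continuous
  have hcc : ∀ b, Continuous fun θ : ℝ => hankelKernel b (L + θ * Complex.I) :=
    fun b => (hc b).comp (by fun_prop)
  have hlim : Tendsto (fun r : ℝ => Real.exp (-Real.exp r) * Real.exp ((1 - (b + 1)) * r)) atTop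
      (𝓝 0) := by
    have h := (Real.tendsto_exp_neg_atTop_nhds_zero).comp Real.tendsto_exp_atTop
    have h2 := (tendsto_rpow_mul_exp_neg_mul_atTop_nhds_zero (-b) 1 one_pos).comp
      Real.tendsto_exp_atTop
    refine h2.congr fun r => ?_
    simp only [Function.comp, ← Real.exp_mul]
    rw [mul_comm]
    ring_nf
  have limt : Tendsto (fun r : ℝ => hankelKernel (b + 1) (r + Real.pi * Complex.I)) atTop (𝓝 0) := by
    simp only [hankelKernel_top]
    simpa using ((Complex.continuous_ofReal.tendsto 0).comp hlim).mul_const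
      (Complex.exp (Real.pi * (1 - ((b + 1 : ℝ) : ℂ)) * Complex.I))
  have limb : Tendsto (fun r : ℝ => hankelKernel (b + 1) (r - Real.pi * Complex.I)) atTop (𝓝 0) := by
    simp only [hankelKernel_bot]
    simpa using ((Complex.continuous_ofReal.tendsto 0).comp hlim).mul_const
      (Complex.exp (-(Real.pi * (1 - ((b + 1 : ℝ) : ℂ)) * Complex.I)))
  have t := integral_Ioi_of_hasDerivAt_of_tendsto' (a := L)
    (fun r _ => ((hd _).comp_add_const (r : ℂ) (Real.pi * Complex.I)).comp_ofReal)
    ((integrableOn_hankelKernel_top b L).sub ((integrableOn_hankelKernel_top (b + 1) L).const_mul b))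
    limt
  have bt := integral_Ioi_of_hasDerivAt_of_tendsto' (a := L)
    (fun r _ => ((hd _).comp_sub_const (r : ℂ) (Real.pi * Complex.I)).comp_ofReal)
    ((integrableOn_hankelKernel_bot b L).sub ((integrableOn_hankelKernel_bot (b + 1) L).const_mul b))
    limb
  have s := intervalIntegral.integral_eq_sub_of_hasDerivAt (a := -Real.pi) (b := Real.pi)
    (f := fun θ : ℝ => hankelKernel (b + 1) (L + θ * Complex.I))
    (f' := fun θ : ℝ => Complex.I * (hankelKernel b (L + θ * Complex.I)
      - b * hankelKernel (b + 1) (L + θ * Complex.I)))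
    (fun θ _ => by
      have h1 : HasDerivAt (fun z : ℂ => L + z * Complex.I) Complex.I (θ : ℂ) := by
        simpa using ((hasDerivAt_id (θ : ℂ)).mul_const Complex.I).const_add (L : ℂ)
      have := (HasDerivAt.comp (θ : ℂ) (hd _) h1).comp_ofReal
      rw [mul_comm]
      exact this)
    (by
      apply Continuous.intervalIntegrable
      exact continuous_const.mul (((hc b).comp (by fun_prop)).sub
        (continuous_const.mul ((hc (b + 1)).comp (by fun_prop)))))
  rw [integral_sub (integrableOn_hankelKernel_top b L)
    ((integrableOn_hankelKernel_top (b + 1) L).const_mul _), integral_const_mul] at t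
  rw [integral_sub (integrableOn_hankelKernel_bot b L)
    ((integrableOn_hankelKernel_bot (b + 1) L).const_mul _), integral_const_mul] at bt
  rw [intervalIntegral.integral_const_mul, intervalIntegral.integral_sub
    ((hcc b).intervalIntegrable _ _) (((hcc (b + 1)).intervalIntegrable _ _).const_mul _),
    intervalIntegral.integral_const_mul] at s
  simp only [Complex.ofReal_neg, neg_mul, ← sub_eq_add_neg] at s
  simp only [hankel]
  linear_combination t - bt + s

/-- **Hankel's formula** for `1 / Γ`, at every real argument. -/
theorem hankel_kernel (b L : ℝ) :
    hankel (hankelKernel b) L = 2 * Real.pi * Complex.I * (Complex.Gamma b)⁻¹ := by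
  obtain ⟨n, hn⟩ := exists_nat_gt b
  induction n generalizing b with
  | zero => exact hankel_kernel_of_lt_one (by push_cast at hn; linarith) L
  | succ n ih =>
    rcases eq_or_ne b 1 with rfl | hb
    · rw [hankel_kernel_one]; simp
    · have h1 := hankel_kernel_add_one (b - 1) L
      rw [ih (b - 1) (by push_cast at hn; linarith)] at h1
      have h2 := Complex.one_div_Gamma_eq_self_mul_one_div_Gamma_add_one ((b - 1 : ℝ) : ℂ)
      have h3 : ((b - 1 : ℝ) : ℂ) ≠ 0 := by exact_mod_cast sub_ne_zero.2 hb
      have h4 : ((b - 1 : ℝ) : ℂ) + 1 = b := by push_cast; ring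
      rw [h4] at h2
      rw [h2, sub_add_cancel] at h1
      exact mul_left_cancel₀ h3 (by linear_combination -h1)

/-! ### Integrals for the Mittag-Leffler series and its remainder -/

theorem hankelKernel_mul_pow (a b : ℝ) (z v : ℂ) (n : ℕ) :
    z ^ n * hankelKernel (a * n + b) v = hankelKernel b v * (z * Complex.exp (-(a * v))) ^ n := by
  rw [mul_pow, ← Complex.exp_nat_mul, hankelKernel, hankelKernel, mul_left_comm, ← Complex.exp_add]
  push_cast
  ring_nf

theorem hasSum_integral_hankelKernel {a b L : ℝ} {z : ℂ} (ha : 0 < a)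
    (hz : ‖z‖ < Real.exp (a * L)) {μ : Measure ℝ} {γ : ℝ → ℂ} (hγ : Continuous γ)
    (hre : ∀ᵐ r ∂μ, L ≤ (γ r).re) (hint : Integrable (fun r => hankelKernel b (γ r)) μ) :
    HasSum (fun n : ℕ => ∫ r, z ^ n * hankelKernel (a * n + b) (γ r) ∂μ)
      (∫ r, hankelKernel b (γ r) / (1 - z * Complex.exp (-(a * γ r))) ∂μ) := by
  set q : ℝ := ‖z‖ * Real.exp (-(a * L)) with hq
  have hq0 : 0 ≤ q := by positivity
  have hq1 : q < 1 := by
    rw [hq, Real.exp_neg, ← div_eq_mul_inv, div_lt_one (Real.exp_pos _)]; exact hz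
  have hle : ∀ᵐ r ∂μ, ‖z * Complex.exp (-(a * γ r))‖ ≤ q := by
    filter_upwards [hre] with r hr
    rw [norm_mul, Complex.norm_exp, hq]
    gcongr
    simpa using mul_le_mul_of_nonneg_left hr ha.le
  have hc : ∀ b, Continuous fun r => hankelKernel b (γ r) :=
    fun b => (differentiable_hankelKernel b).continuous.comp hγ
  refine hasSum_integral_of_dominated_convergence (fun n r => ‖hankelKernel b (γ r)‖ * q ^ n)
    (fun n => (continuous_const.mul (hc _)).aestronglyMeasurable) (fun n => ?_) ?_ ?_ ?_
  · filter_upwards [hle] with r hr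
    rw [hankelKernel_mul_pow, norm_mul, norm_pow]
    gcongr
  · exact Eventually.of_forall fun r => (summable_geometric_of_lt_one hq0 hq1).mul_left _
  · simp only [tsum_mul_left]
    exact hint.norm.mul_const _
  · filter_upwards [hle] with r hr
    simp only [hankelKernel_mul_pow, div_eq_mul_inv]
    exact (hasSum_geometric_of_norm_lt_one (hr.trans_lt hq1)).mul_left _

/-- Summing Hankel's formula as a geometric series on a contour of radius `exp L > ‖z‖ ^ (1 / a)`
gives both the convergence of the Mittag-Leffler series and an integral for its sum. -/
theorem hasSum_mlTerm {a b L : ℝ} {z : ℂ} (ha : 0 < a) (hz : ‖z‖ < Real.exp (a * L)) :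
    HasSum (mlTerm a b z) ((2 * Real.pi * Complex.I)⁻¹ *
      hankel (fun v => hankelKernel b v / (1 - z * Complex.exp (-(a * v)))) L) := by
  have hpi : -Real.pi ≤ Real.pi := by linarith [Real.pi_pos]
  have ht := hasSum_integral_hankelKernel ha hz (b := b) (μ := volume.restrict (Ioi L))
    (γ := fun r => r + Real.pi * Complex.I) (by fun_prop)
    (by filter_upwards [ae_restrict_mem measurableSet_Ioi] with r hr using by simpa using hr.le)
    (integrableOn_hankelKernel_top b L)
  have hb := hasSum_integral_hankelKernel ha hz (b := b) (μ := volume.restrict (Ioi L))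
    (γ := fun r => r - Real.pi * Complex.I) (by fun_prop)
    (by filter_upwards [ae_restrict_mem measurableSet_Ioi] with r hr using by simpa using hr.le)
    (integrableOn_hankelKernel_bot b L)
  have hs := hasSum_integral_hankelKernel ha hz (b := b)
    (μ := volume.restrict (Ioc (-Real.pi) Real.pi))
    (γ := fun θ => L + θ * Complex.I) (by fun_prop) (by simp)
    ((intervalIntegrable_iff_integrableOn_Ioc_of_le hpi).1
      (((differentiable_hankelKernel b).continuous.comp (by fun_prop)).intervalIntegrable _ _))
  have h := ((ht.sub hb).add (hs.mul_left Complex.I)).mul_left (2 * Real.pi * Complex.I)⁻¹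
  rw [hankel, intervalIntegral.integral_of_le hpi]
  refine h.congr_fun fun n => ?_
  have hk := hankel_kernel (a * n + b) L
  rw [hankel, intervalIntegral.integral_of_le hpi] at hk
  have h2 : (2 * Real.pi * Complex.I : ℂ) ≠ 0 := by simp [Real.pi_ne_zero]
  rw [mlTerm, div_eq_mul_inv, eq_comm, inv_mul_eq_iff_eq_mul₀ h2]
  simp only [integral_const_mul]
  linear_combination z ^ n * hk

theorem summable_mlTerm {a : ℝ} (ha : 0 < a) (b : ℝ) (z : ℂ) : Summable (mlTerm a b z) := by
  refine (hasSum_mlTerm (L := (‖z‖ + 1) / a) ha ?_).summable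
  rw [mul_div_cancel₀ _ ha.ne']
  linarith [Real.add_one_le_exp (‖z‖ + 1)]

theorem mittagLeffler_eq_neg_sum_add_remainder {a x : ℝ} (ha : 0 < a) (hx : x ≠ 0) (M : ℕ) :
    mittagLeffler a (-(x : ℂ)) =
      -∑ k ∈ Finset.Icc 1 M, (-(x : ℂ)) ^ (-(k : ℤ)) / Complex.Gamma ((1 - a * k : ℝ) : ℂ)
        + remainder M a (-(x : ℂ)) := by
  have hz : (-(x : ℂ)) ≠ 0 := by simpa using hx
  generalize (-(x : ℂ)) = z at hz
  rw [remainder, mittagLeffler, mittagLeffler₂, mittagLeffler₂,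
    ← (summable_mlTerm ha (1 - a * M) z).sum_add_tsum_nat_add M, mul_add, Finset.mul_sum,
    ← tsum_mul_left]
  have h1 : ∀ n, z ^ (-(M : ℤ)) * mlTerm a (1 - a * M) z (n + M) = mlTerm a 1 z n := by
    intro n
    rw [mlTerm, mlTerm, mul_div_assoc', pow_add, mul_left_comm, zpow_neg, zpow_natCast,
      inv_mul_cancel₀ (pow_ne_zero _ hz), mul_one]
    congr 3
    push_cast; ring
  have h2 : ∑ k ∈ Finset.Icc 1 M, z ^ (-(k : ℤ)) / Complex.Gamma ((1 - a * k : ℝ) : ℂ)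
      = ∑ n ∈ Finset.range M, z ^ (-(M : ℤ)) * mlTerm a (1 - a * M) z n := by
    rw [← Finset.sum_range_reflect, Finset.range_eq_Ico, Finset.sum_Ico_eq_sum_range,
      ← Finset.Ico_add_one_right_eq_Icc, Finset.sum_Ico_eq_sum_range]
    refine Finset.sum_congr (by simp) fun k hk => ?_
    have hk : k < M := by simpa using hk
    obtain ⟨j, rfl⟩ : ∃ j, M = k + 1 + j := ⟨M - (k + 1), by omega⟩
    have : k + 1 + j - 1 - (0 + k) = j := by omega
    rw [this, mlTerm, mul_div_assoc']
    congr 1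
    · rw [← zpow_natCast z j, ← zpow_add₀ hz]
      congr 1; push_cast; ring
    · congr 2; push_cast; ring
  simp only [h1, h2]
  ring

/-- The integrand of `E_{a, 1 - a M}(-x)` on the Hankel contour, `exp s * s ^ (a (M + 1)) / (s ^ a + x)`
times `ds / s`, with `s = exp v`. -/
def remainderKernel (M : ℕ) (a x : ℝ) (v : ℂ) : ℂ :=
  Complex.exp (Complex.exp v) * Complex.exp (a * (M + 1) * v) / (Complex.exp (a * v) + x)

/-- The distance from `-x` to a ray at angle `θ` is at least `x |sin θ|`. -/
theorem le_norm_add_ofReal (r θ : ℝ) {x : ℝ} (hx : 0 ≤ x) :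
    x * |Real.sin θ| ≤ ‖Complex.exp (r + θ * Complex.I) + x‖ := by
  have h : ‖Complex.exp (r + θ * Complex.I) + x‖
      = ‖Complex.exp r + x * Complex.exp (-(θ * Complex.I))‖ := by
    have : Complex.exp (r + θ * Complex.I) + x
        = Complex.exp (θ * Complex.I) * (Complex.exp r + x * Complex.exp (-(θ * Complex.I))) := by
      rw [mul_add, mul_left_comm, ← Complex.exp_add, ← Complex.exp_add]
      simp [add_comm]
    rw [this, norm_mul, Complex.norm_exp_ofReal_mul_I, one_mul]
  rw [h]
  refine le_trans (le_of_eq ?_) (Complex.abs_im_le_norm _)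
  rw [← Complex.ofReal_exp, Complex.add_im, Complex.ofReal_im, Complex.im_ofReal_mul, ← neg_mul,
    ← Complex.ofReal_neg, Complex.exp_ofReal_mul_I_im, zero_add, abs_mul, abs_of_nonneg hx,
    Real.sin_neg, abs_neg]

/-- For `a < 1` the equation `s ^ a = -x` has no solution with `|arg s| ≤ π`, so collapsing the
contour meets no pole. -/
theorem exp_mul_add_ne_zero {a x : ℝ} (ha : 0 < a) (ha1 : a < 1) (hx : 0 < x) {v : ℂ}
    (hv : |v.im| ≤ Real.pi) : Complex.exp (a * v) + x ≠ 0 := by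
  intro h
  have him := congrArg Complex.im h
  have hre := congrArg Complex.re h
  simp only [Complex.add_im, Complex.add_re, Complex.exp_im, Complex.exp_re, Complex.re_ofReal_mul,
    Complex.im_ofReal_mul, Complex.ofReal_im, Complex.ofReal_re, Complex.zero_im, Complex.zero_re,
    add_zero] at him hre
  have hs := (mul_eq_zero.1 him).resolve_left (Real.exp_pos _).ne'
  have hpi := Real.pi_pos
  rw [abs_le] at hv
  have h0 := (Real.sin_eq_zero_iff_of_lt_of_lt (by nlinarith) (by nlinarith)).1 hs
  rw [h0, Real.cos_zero, mul_one] at hre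
  linarith [Real.exp_pos (a * v.re)]

theorem remainderKernel_conj (M : ℕ) (a x : ℝ) (v : ℂ) :
    remainderKernel M a x (starRingEnd ℂ v) = starRingEnd ℂ (remainderKernel M a x v) := by
  simp [remainderKernel, ← Complex.exp_conj]

theorem remainderKernel_bot (M : ℕ) (a x r : ℝ) : remainderKernel M a x (r - Real.pi * Complex.I) =
    starRingEnd ℂ (remainderKernel M a x (r + Real.pi * Complex.I)) := by
  rw [← remainderKernel_conj]; congr 1; simp [sub_eq_add_neg]

theorem integrable_remainderKernel_top (M : ℕ) {a x : ℝ} (ha : 0 < a) (ha1 : a < 1) (hx : 0 < x) :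
    Integrable fun r : ℝ => remainderKernel M a x (r + Real.pi * Complex.I) := by
  have hsin : 0 < Real.sin (a * Real.pi) :=
    Real.sin_pos_of_pos_of_lt_pi (by positivity) (by nlinarith [Real.pi_pos])
  have hne : ∀ r : ℝ, Complex.exp (a * (r + Real.pi * Complex.I)) + x ≠ 0 := fun r =>
    exp_mul_add_ne_zero ha ha1 hx (by simp [abs_of_pos Real.pi_pos])
  have hcont : Continuous fun r : ℝ => remainderKernel M a x (r + Real.pi * Complex.I) := by
    unfold remainderKernel
    exact Continuous.div (by fun_prop) (by fun_prop) hne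
  refine ((integrable_exp_neg_exp (p := a * (M + 1)) (by positivity)).mul_const
    (x * Real.sin (a * Real.pi))⁻¹).mono' hcont.aestronglyMeasurable (Eventually.of_forall fun r => ?_)
  rw [remainderKernel, norm_div, norm_mul, div_eq_mul_inv]
  have h := le_norm_add_ofReal (a * r) (a * Real.pi) hx.le
  rw [abs_of_pos hsin] at h
  have h2 : (a : ℂ) * (r + Real.pi * Complex.I)
      = ((a * r : ℝ) : ℂ) + ((a * Real.pi : ℝ) : ℂ) * Complex.I := by push_cast; ring
  rw [h2]
  gcongr
  · rw [Complex.norm_exp, exp_add_pi, Complex.neg_re, Complex.ofReal_re]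
  · rw [Complex.norm_exp]; simp

theorem tendsto_remainderKernel_side (M : ℕ) {a x : ℝ} (ha : 0 < a) (ha1 : a < 1) (hx : 0 < x) :
    Tendsto (fun L : ℝ => ∫ θ in (-Real.pi)..Real.pi, remainderKernel M a x (L + θ * Complex.I))
      atBot (𝓝 0) := by
  have h := tendsto_side (F := remainderKernel M a x) (c := 0)
    (e := fun L => Real.exp (Real.exp L) * Real.exp (a * (M + 1) * L) * (x / 2)⁻¹) ?_ ?_ ?_
  · simpa using h
  · have h1 : Tendsto (fun L : ℝ => Real.exp (Real.exp L)) atBot (𝓝 (Real.exp 0)) :=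
      (Real.continuous_exp.tendsto 0).comp Real.tendsto_exp_atBot
    have h2 : Tendsto (fun L : ℝ => Real.exp (a * (M + 1) * L)) atBot (𝓝 0) :=
      Real.tendsto_exp_atBot.comp (tendsto_id.const_mul_atBot (by positivity))
    simpa using (h1.mul h2).mul_const (x / 2)⁻¹
  · intro L
    refine ContinuousOn.intervalIntegrable ?_
    rw [uIcc_of_le (by linarith [Real.pi_pos])]
    unfold remainderKernel
    refine ContinuousOn.div (by fun_prop) (by fun_prop) fun θ hθ => ?_
    exact exp_mul_add_ne_zero ha ha1 hx (by simpa using abs_le.2 hθ)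
  · have h1 : Tendsto (fun L : ℝ => Real.exp (a * L)) atBot (𝓝 0) :=
      Real.tendsto_exp_atBot.comp (tendsto_id.const_mul_atBot ha)
    filter_upwards [h1.eventually_le_const (half_pos hx)] with L hL θ
    have hn : ‖Complex.exp (a * (L + θ * Complex.I))‖ = Real.exp (a * L) := by
      rw [Complex.norm_exp]; simp
    have h2 : x / 2 ≤ ‖Complex.exp (a * (L + θ * Complex.I)) + x‖ := by
      have := norm_sub_le_norm_add (x : ℂ) (Complex.exp (a * (L + θ * Complex.I)))
      rw [hn, Complex.norm_real, Real.norm_of_nonneg hx.le, add_comm] at this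
      linarith
    rw [sub_zero, remainderKernel, norm_div, norm_mul, div_eq_mul_inv]
    gcongr
    · refine (Complex.norm_exp_le_exp_norm _).trans_eq ?_
      rw [Complex.norm_exp]; simp
    · rw [Complex.norm_exp]; simp

/-- The remainder as an integral over the cut; the integrands on its two sides are conjugate. -/
theorem remainder_eq_im_integral (M : ℕ) {a x : ℝ} (ha : 0 < a) (ha1 : a < 1) (hx : 0 < x) :
    remainder M a (-(x : ℂ)) = (((-x) ^ (-(M : ℤ)) / Real.pi *
      (∫ r : ℝ, remainderKernel M a x (r + Real.pi * Complex.I)).im : ℝ) : ℂ) := by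
  have hz : ‖(-(x : ℂ))‖ < Real.exp (a * ((x + 1) / a)) := by
    rw [mul_div_cancel₀ _ ha.ne', norm_neg, Complex.norm_real, Real.norm_of_nonneg hx.le]
    linarith [Real.add_one_le_exp (x + 1)]
  have hF : (fun v => hankelKernel (1 - a * M) v / (1 - -(x : ℂ) * Complex.exp (-(a * v))))
      = remainderKernel M a x := by
    funext v
    have h1 : 1 - -(x : ℂ) * Complex.exp (-(a * v))
        = (Complex.exp (a * v) + x) / Complex.exp (a * v) := by
      rw [Complex.exp_neg, add_div, div_self (Complex.exp_ne_zero _)]; ring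
    have h2 : (a * (M + 1) * v : ℂ) = (1 - ((1 - a * M : ℝ) : ℂ)) * v + a * v := by
      push_cast; ring
    rw [h1, div_div_eq_mul_div, hankelKernel, remainderKernel, h2, Complex.exp_add,
      Complex.exp_add, mul_assoc]
  have hi := integrable_remainderKernel_top M ha ha1 hx
  have h := (hasSum_mlTerm (b := 1 - a * M) ha hz).tsum_eq
  rw [hF, hankel_eq_integral] at h
  · simp only [remainderKernel_bot, integral_conj] at h
    rw [remainder, mittagLeffler₂, h, Complex.sub_conj]
    push_cast
    field_simp [Real.pi_ne_zero]
  · intro v hv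
    unfold remainderKernel
    exact DifferentiableAt.div (by fun_prop) (by fun_prop) (exp_mul_add_ne_zero ha ha1 hx hv)
  · exact hi
  · simp only [remainderKernel_bot]
    exact (LinearIsometryEquiv.integrable_comp_iff Complex.conjLIE).2 hi
  · exact tendsto_remainderKernel_side M ha ha1 hx

/-! ### The Gaussian integral of a simple pole -/

theorem sub_eq_mul_integral_of_hasDerivAt {Q q : ℂ → ℂ} (hq : Continuous q)
    (hQ : ∀ z, HasDerivAt Q (q z) z) (z w : ℂ) :
    Q (z + w) - Q z = w * ∫ s in (0 : ℝ)..1, q (z + w * s) := by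
  have h := intervalIntegral.integral_eq_sub_of_hasDerivAt (a := 0) (b := 1)
    (f := fun s : ℝ => Q (z + w * s)) (f' := fun s : ℝ => w * q (z + w * s))
    (fun s _ => by
      have h1 : HasDerivAt (fun t : ℂ => z + w * t) w (s : ℂ) := by
        simpa using ((hasDerivAt_id (s : ℂ)).const_mul w).const_add z
      have := (HasDerivAt.comp (s : ℂ) (hQ _) h1).comp_ofReal
      rw [mul_comm]
      exact this)
    ((continuous_const.mul (hq.comp (by fun_prop))).intervalIntegrable _ _)
  rw [intervalIntegral.integral_const_mul] at h
  rw [h]; simp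

theorem integrable_exp_neg_add_sq (w : ℂ) :
    Integrable fun s : ℝ => Complex.exp (-(w + s) ^ 2) := by
  have h := integrable_cexp_quadratic (b := 1) (by simp) (-2 * w) (-w ^ 2)
  refine h.congr (Eventually.of_forall fun s => ?_)
  simp only
  ring_nf

/-- The integral along the horizontal ray from `w`, compared with that along the positive axis by
means of a primitive of `exp (-z²)`. -/
theorem integral_exp_neg_add_sq {w : ℂ} (hw : 0 < w.re) :
    ∫ s in Ioi (0 : ℝ), Complex.exp (-(w + s) ^ 2) = (Real.sqrt Real.pi : ℂ) / 2 * erfc w := by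
  obtain ⟨Q, hQ⟩ := Differentiable.isExactOn_univ (f := fun z : ℂ => Complex.exp (-z ^ 2))
    (by fun_prop)
  replace hQ : ∀ z, HasDerivAt Q (Complex.exp (-z ^ 2)) z := fun z => hQ z (mem_univ z)
  have hcont : Continuous fun z : ℂ => Complex.exp (-z ^ 2) := by fun_prop
  have hd : ∀ (w : ℂ) (S : ℝ), HasDerivAt (fun s : ℝ => Q (w + s)) (Complex.exp (-(w + S) ^ 2)) S :=
    fun w S => ((hQ _).comp_const_add w (S : ℂ)).comp_ofReal
  have hlim : ∀ w : ℂ, Tendsto (fun S : ℝ => Q (w + S) - Q w) atTop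
      (𝓝 (∫ s in Ioi (0 : ℝ), Complex.exp (-(w + s) ^ 2))) := by
    intro w
    refine (intervalIntegral_tendsto_integral_Ioi 0 (integrable_exp_neg_add_sq w).integrableOn
      tendsto_id).congr fun S => ?_
    rw [intervalIntegral.integral_eq_sub_of_hasDerivAt (fun s _ => hd w s)
      ((integrable_exp_neg_add_sq w).intervalIntegrable)]
    simp
  have h0 : ∫ s in Ioi (0 : ℝ), Complex.exp (-(0 + (s : ℂ)) ^ 2) = (Real.sqrt Real.pi : ℂ) / 2 := by
    have := integral_gaussian_Ioi 1
    simp only [div_one] at this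
    rw [← Complex.ofReal_ofNat, ← Complex.ofReal_div, ← this, ← integral_complex_ofReal]
    congr 1 with s
    push_cast; ring_nf
  have hl0 := hlim 0
  rw [h0] at hl0
  have hdiff : Tendsto (fun S : ℝ => Q (w + S) - Q (0 + S)) atTop (𝓝 0) := by
    refine squeeze_zero_norm' (a := fun S : ℝ => ‖w‖ * (Real.exp (w.im ^ 2) * Real.exp (-S))) ?_ ?_
    · filter_upwards [eventually_ge_atTop 1] with S hS
      rw [add_comm w, zero_add, sub_eq_mul_integral_of_hasDerivAt hcont hQ, norm_mul]
      gcongr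
      refine (intervalIntegral.norm_integral_le_of_norm_le_const
        (C := Real.exp (w.im ^ 2) * Real.exp (-S)) fun t ht => ?_).trans_eq (by simp)
      rw [uIoc_of_le zero_le_one] at ht
      rw [Complex.norm_exp, ← Real.exp_add]
      gcongr
      have h1 : (-(S + w * t) ^ 2).re = -(S + w.re * t) ^ 2 + (w.im * t) ^ 2 := by
        simp [pow_two]
        ring
      rw [h1, mul_pow]
      have h2 : 0 ≤ w.re * t := mul_nonneg hw.le ht.1.le
      have h3 : t ^ 2 ≤ 1 := pow_le_one₀ ht.1.le ht.2
      nlinarith [mul_le_mul_of_nonneg_left h3 (sq_nonneg w.im)]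
    · simpa using ((Real.tendsto_exp_neg_atTop_nhds_zero).const_mul (Real.exp (w.im ^ 2))).const_mul
        ‖w‖
  have e1 := sub_eq_mul_integral_of_hasDerivAt hcont hQ 0 w
  have h3 := (hlim w).sub (hl0.add hdiff)
  have h4 : ∀ S : ℝ, Q (w + S) - Q w - (Q (0 + S) - Q 0 + (Q (w + S) - Q (0 + S))) = Q 0 - Q w := by
    intro S; ring
  simp only [h4] at h3
  have h5 := tendsto_nhds_unique h3 tendsto_const_nhds
  rw [erfc]
  simp only [zero_add] at e1
  have hpi : (Real.sqrt Real.pi : ℂ) ≠ 0 := by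
    simp [Real.sqrt_eq_zero', Real.pi_pos]
  have h6 : (Real.sqrt Real.pi : ℂ) * (2 / Real.sqrt Real.pi) = 2 := mul_div_cancel₀ _ hpi
  linear_combination h5 - e1
    + (w * ∫ s in (0 : ℝ)..1, Complex.exp (-(w * s) ^ 2)) / 2 * h6

/-- The Gaussian integral of a simple pole `i w` in the upper half plane. Writing
`1 / (v - i w) = 2 i ∫_0^∞ exp (-2 (w + i v) s) ds` and integrating first over `v` reduces it to
`integral_exp_neg_add_sq`. -/
theorem integral_gaussian_div_sub {w : ℂ} (hw : 0 < w.re) :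
    ∫ v : ℝ, Complex.exp (-(v : ℂ) ^ 2) / (v - Complex.I * w)
      = Complex.I * Real.pi * Complex.exp (w ^ 2) * erfc w := by
  have hre : ∀ v : ℝ, (-2 * (w + Complex.I * v)).re < 0 := by intro v; simp [hw]
  have hne : ∀ v : ℝ, w + Complex.I * v ≠ 0 := by
    intro v h; have := hre v; rw [h] at this; simp at this
  have h1 : ∀ v : ℝ, Complex.exp (-(v : ℂ) ^ 2) / (v - Complex.I * w)
      = 2 * Complex.I * ∫ s in Ioi (0 : ℝ), Complex.exp (-(v : ℂ) ^ 2)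
          * Complex.exp (-2 * (w + Complex.I * v) * s) := by
    intro v
    rw [integral_const_mul, integral_exp_mul_complex_Ioi (hre v)]
    have h2 : (v : ℂ) - Complex.I * w = -Complex.I * (w + Complex.I * v) := by
      linear_combination (v : ℂ) * Complex.I_sq
    rw [h2]
    have := hne v
    simp only [Complex.ofReal_zero, mul_zero, Complex.exp_zero]
    generalize w + Complex.I * v = c at this
    have hI := Complex.I_ne_zero
    rw [div_eq_iff (by simp [this])]
    field_simp
    linear_combination Complex.I_sq
  have hint : Integrable (Function.uncurry fun (v s : ℝ) => Complex.exp (-(v : ℂ) ^ 2)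
      * Complex.exp (-2 * (w + Complex.I * v) * s)) (volume.prod (volume.restrict (Ioi 0))) := by
    have ha := integrable_exp_neg_mul_sq one_pos
    have hb := integrableOn_exp_mul_Ioi (a := -2 * w.re) (by linarith) 0
    refine (ha.mul_prod hb).mono' (by fun_prop) (Eventually.of_forall fun p => ?_)
    simp only [Function.uncurry, norm_mul, Complex.norm_exp]
    refine le_of_eq ?_
    congr 2 <;> simp [← Complex.ofReal_pow]
  simp only [h1]
  rw [integral_const_mul, integral_integral_swap hint]
  have h3 : ∀ s : ℝ, ∫ v : ℝ, Complex.exp (-(v : ℂ) ^ 2) * Complex.exp (-2 * (w + Complex.I * v) * s)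
      = Real.sqrt Real.pi * Complex.exp (w ^ 2) * Complex.exp (-(w + s) ^ 2) := by
    intro s
    have h := fourierIntegral_gaussian (b := 1) (by simp) (-2 * s)
    have h4 : ∀ v : ℝ, Complex.exp (-(v : ℂ) ^ 2) * Complex.exp (-2 * (w + Complex.I * v) * s)
        = Complex.exp (-2 * w * s)
          * (Complex.exp (Complex.I * (-2 * s) * v) * Complex.exp (-1 * v ^ 2)) := by
      intro v
      rw [← Complex.exp_add, ← Complex.exp_add, ← Complex.exp_add]
      ring_nf
    simp only [h4]
    rw [integral_const_mul, h, div_one, Real.sqrt_eq_rpow, Complex.ofReal_cpow Real.pi_pos.le,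
      mul_left_comm, ← Complex.exp_add, mul_assoc _ (Complex.exp _) (Complex.exp _),
      ← Complex.exp_add]
    push_cast
    congr 2
    ring
  simp only [h3]
  rw [integral_const_mul, integral_exp_neg_add_sq hw]
  have hpi : (Real.sqrt Real.pi : ℂ) * Real.sqrt Real.pi = Real.pi := by
    rw [← Complex.ofReal_mul, Real.mul_self_sqrt Real.pi_pos.le]
  linear_combination (Complex.I * Complex.exp (w ^ 2) * erfc w) * hpi

theorem integral_gaussian_div_sub_scaled {c : ℂ} (hc : 0 < c.re) {X : ℝ} (hX : 0 < X) :
    ∫ u : ℝ, (Real.exp (-(X * u ^ 2 / 2)) : ℂ) * (1 / (u - Complex.I * c))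
      = Complex.I * Real.pi * Complex.exp (X * c ^ 2 / 2) * erfc (c * (Real.sqrt (X / 2) : ℝ)) := by
  set l := Real.sqrt (X / 2) with hl
  have hl0 : 0 < l := Real.sqrt_pos.2 (by positivity)
  have hl2 : l ^ 2 = X / 2 := Real.sq_sqrt (by positivity)
  have h := integral_gaussian_div_sub (w := c * l) (by simpa using mul_pos hc hl0)
  have h2 := Measure.integral_comp_mul_left
    (fun v : ℝ => Complex.exp (-(v : ℂ) ^ 2) / (v - Complex.I * (c * l))) l
  rw [h] at h2
  have hl2c : (l : ℂ) ^ 2 = X / 2 := by exact_mod_cast hl2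
  have h3 : ∀ u : ℝ, (Real.exp (-(X * u ^ 2 / 2)) : ℂ) * (1 / (u - Complex.I * c))
      = l * (Complex.exp (-((l * u : ℝ) : ℂ) ^ 2) / ((l * u : ℝ) - Complex.I * (c * l))) := by
    intro u
    have h5 : ((l * u : ℝ) : ℂ) - Complex.I * (c * l) = l * (u - Complex.I * c) := by
      push_cast; ring
    have hl0' : (l : ℂ) ≠ 0 := by exact_mod_cast hl0.ne'
    have h6 : (-((l * u : ℝ) : ℂ) ^ 2) = ((-(X * u ^ 2 / 2) : ℝ) : ℂ) := by
      push_cast; rw [mul_pow, hl2c]; ring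
    rw [h5, h6, ← Complex.ofReal_exp, mul_one_div, mul_div_assoc', mul_div_mul_left _ _ hl0']
  simp only [h3]
  rw [integral_const_mul, h2, abs_of_pos (inv_pos.2 hl0), Complex.real_smul, ← mul_assoc,
    ← Complex.ofReal_mul, mul_inv_cancel₀ hl0.ne', mul_pow, hl2c]
  simp only [Complex.ofReal_one, one_mul]
  ring_nf

/-! ### The function `2 (exp z - 1 - z) / z²` and the root `c` -/

/-- The entire function `2 (exp z - 1 - z) / z²`, with the value `1` at `0`. -/
def expQuot (z : ℂ) : ℂ := 2 * dslope (dslope Complex.exp 0) 0 z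

theorem differentiable_expQuot : Differentiable ℂ expQuot := by
  have h1 : DifferentiableOn ℂ (dslope Complex.exp 0) univ :=
    (Complex.differentiableOn_dslope univ_mem).2 Complex.differentiable_exp.differentiableOn
  have h2 : DifferentiableOn ℂ (dslope (dslope Complex.exp 0) 0) univ :=
    (Complex.differentiableOn_dslope univ_mem).2 h1
  exact (differentiableOn_univ.1 h2).const_mul 2

theorem sq_mul_expQuot (z : ℂ) : z ^ 2 * expQuot z = 2 * (Complex.exp z - 1 - z) := by
  have h1 := sub_smul_dslope Complex.exp 0 z
  have h2 := sub_smul_dslope (dslope Complex.exp 0) 0 z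
  have h3 : dslope Complex.exp 0 0 = 1 := by rw [dslope_same]; simp
  rw [h3] at h2
  simp only [sub_zero, smul_eq_mul, Complex.exp_zero] at h1 h2
  rw [expQuot]
  linear_combination 2 * z * h2 + 2 * h1

theorem expQuot_eq_div {z : ℂ} (hz : z ≠ 0) : expQuot z = 2 * (Complex.exp z - 1 - z) / z ^ 2 := by
  rw [eq_div_iff (pow_ne_zero 2 hz), ← sq_mul_expQuot, mul_comm]

theorem expQuot_sub_taylor_isBigO :
    (fun z : ℂ => expQuot z - (1 + z / 3 + z ^ 2 / 12 + z ^ 3 / 60 + z ^ 4 / 360))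
      =O[𝓝[≠] 0] fun z => z ^ 5 := by
  refine IsBigO.of_bound 1 ?_
  filter_upwards [self_mem_nhdsWithin, mem_nhdsWithin_of_mem_nhds (Metric.ball_mem_nhds 0 one_pos)]
    with z hz hz1
  have hz : z ≠ 0 := hz
  have hn : 0 < ‖z‖ := norm_pos_iff.2 hz
  have hb := Complex.exp_bound (x := z) (by simpa using (mem_ball_zero_iff.1 hz1).le)
    (n := 7) (by norm_num)
  have h : expQuot z - (1 + z / 3 + z ^ 2 / 12 + z ^ 3 / 60 + z ^ 4 / 360)
      = 2 * (Complex.exp z - ∑ m ∈ Finset.range 7, z ^ m / m.factorial) / z ^ 2 := by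
    rw [expQuot_eq_div hz]
    simp only [Finset.sum_range_succ, Finset.sum_range_zero, Nat.factorial]
    push_cast
    field_simp
    ring
  rw [h, norm_div, norm_mul, norm_pow, norm_pow, div_le_iff₀ (by positivity)]
  have h2 : ((Nat.succ 7 : ℕ) : ℝ) * (((Nat.factorial 7 : ℕ) : ℝ) * (7 : ℕ))⁻¹ ≤ 1 / 2 := by
    norm_num [Nat.factorial]
  have h3 : ‖(2 : ℂ)‖ = 2 := by simp
  rw [h3]
  calc _ ≤ 2 * (‖z‖ ^ 7 * (1 / 2)) := by
        refine mul_le_mul_of_nonneg_left (hb.trans ?_) two_pos.le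
        exact mul_le_mul_of_nonneg_left h2 (by positivity)
    _ = _ := by ring

theorem expQuot_zero : expQuot 0 = 1 := by
  have h1 : Tendsto (fun z : ℂ => expQuot z - (1 + z / 3 + z ^ 2 / 12 + z ^ 3 / 60 + z ^ 4 / 360))
      (𝓝[≠] 0) (𝓝 0) := by
    refine expQuot_sub_taylor_isBigO.trans_tendsto ?_
    have : Continuous fun z : ℂ => z ^ 5 := by fun_prop
    simpa using this.continuousWithinAt (s := {0}ᶜ) (x := 0) |>.tendsto
  have h2 : Continuous
      (fun z : ℂ => expQuot z - (1 + z / 3 + z ^ 2 / 12 + z ^ 3 / 60 + z ^ 4 / 360)) := by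
    have := differentiable_expQuot.continuous
    fun_prop
  have h3 := tendsto_nhds_unique (h2.continuousWithinAt (s := {0}ᶜ) (x := 0)).tendsto h1
  simpa [sub_eq_zero] using h3

/-- The branch `z √(2 (exp z - 1 - z) / z²)` of `√(2 (exp z - 1 - z))`. On the real line it is
`saddleU ∘ exp`, and `saddleLog` inverts it; on the imaginary axis it is `i` times `cRoot`. -/
def saddlePsi (z : ℂ) : ℂ := z * expQuot z ^ (1 / 2 : ℂ)

theorem cpow_half_sq (z : ℂ) : (z ^ (1 / 2 : ℂ)) ^ 2 = z := by
  rw [← Complex.cpow_nat_mul]; simp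

theorem saddlePsi_sq (z : ℂ) : saddlePsi z ^ 2 = 2 * (Complex.exp z - 1 - z) := by
  rw [saddlePsi, mul_pow, cpow_half_sq, sq_mul_expQuot]

theorem I_mul_cRoot (w : ℝ) : Complex.I * cRoot w = saddlePsi (Complex.I * w) := by
  rcases eq_or_ne w 0 with rfl | hw
  · simp [cRoot, saddlePsi]
  · have hw' : (w : ℂ) ≠ 0 := by exact_mod_cast hw
    have : 2 * (1 + Complex.I * w - Complex.exp (Complex.I * w)) / (w : ℂ) ^ 2
        = expQuot (Complex.I * w) := by
      rw [expQuot_eq_div (mul_ne_zero Complex.I_ne_zero hw'), mul_pow, Complex.I_sq, neg_one_mul,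
        div_neg, ← neg_div]
      congr 1; ring
    rw [cRoot, this, saddlePsi, mul_assoc]

theorem cRoot_sq (w : ℝ) :
    cRoot w ^ 2 / 2 = 1 + Complex.I * w - Complex.exp (Complex.I * w) := by
  have h := saddlePsi_sq (Complex.I * w)
  rw [← I_mul_cRoot, mul_pow, Complex.I_sq] at h
  linear_combination -h / 2

theorem re_cpow_half_pos {z : ℂ} (hz : z ∈ Complex.slitPlane) : 0 < (z ^ (1 / 2 : ℂ)).re := by
  rw [Complex.cpow_def_of_ne_zero (Complex.slitPlane_ne_zero hz), Complex.exp_re]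
  have h : (Complex.log z * (1 / 2)).im = z.arg / 2 := by
    rw [show (1 / 2 : ℂ) = ((1 / 2 : ℝ) : ℂ) by push_cast; rfl, Complex.im_mul_ofReal,
      Complex.log_im]
    ring
  rw [h]
  have h1 := Complex.neg_pi_lt_arg z
  have h2 := Complex.arg_le_pi z
  have h3 := (Complex.mem_slitPlane_iff_arg.1 hz).1
  have h4 := lt_of_le_of_ne h2 h3
  exact mul_pos (Real.exp_pos _) (Real.cos_pos_of_mem_Ioo ⟨by linarith, by linarith⟩)

theorem re_cRoot_pos {w : ℝ} (h0 : 0 < w) (h1 : w < 2 * Real.pi) : 0 < (cRoot w).re := by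
  have hcos : Real.cos w < 1 := by
    refine lt_of_le_of_ne (Real.cos_le_one _) fun h => h0.ne' ?_
    exact (Real.cos_eq_one_iff_of_lt_of_lt (by linarith) h1).1 h
  rw [cRoot, Complex.re_ofReal_mul]
  refine mul_pos h0 (re_cpow_half_pos (Or.inl ?_))
  rw [← Complex.ofReal_pow, Complex.div_ofReal_re]
  refine div_pos ?_ (by positivity)
  have : (2 * (1 + Complex.I * w - Complex.exp (Complex.I * w))).re = 2 * (1 - Real.cos w) := by
    rw [mul_comm Complex.I, Complex.exp_mul_I, ← Complex.ofReal_cos, ← Complex.ofReal_sin]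
    simp [-Complex.ofReal_cos, -Complex.ofReal_sin]
  rw [this]
  linarith

theorem cRoot_sub_taylor_isBigO :
    (fun w : ℝ => cRoot w - ((w : ℂ) + Complex.I / 6 * w ^ 2 - 1 / 36 * w ^ 3
        - Complex.I / 270 * w ^ 4 + 1 / 2592 * w ^ 5)) =O[𝓝 0] fun w : ℝ => w ^ 6 := by
  set S : ℝ → ℂ := fun w => expQuot (Complex.I * w) ^ (1 / 2 : ℂ) with hS
  set P : ℝ → ℂ := fun w => 1 + Complex.I / 6 * w - 1 / 36 * w ^ 2 - Complex.I / 270 * w ^ 3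
    + 1 / 2592 * w ^ 4 with hP
  have hc : ∀ w : ℝ, cRoot w = w * S w := by
    intro w
    have h := I_mul_cRoot w
    rw [saddlePsi, mul_assoc] at h
    exact mul_left_cancel₀ Complex.I_ne_zero h
  have hSc : ContinuousAt S 0 := by
    have h1 : ContinuousAt (fun z : ℂ => z ^ (1 / 2 : ℂ)) (expQuot (Complex.I * (0 : ℝ))) := by
      rw [Complex.ofReal_zero, mul_zero, expQuot_zero]
      exact continuousAt_cpow_const (by simp)
    exact ContinuousAt.comp (f := fun w : ℝ => expQuot (Complex.I * w)) h1
      (differentiable_expQuot.continuous.comp (by fun_prop)).continuousAt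
  have hS0 : S 0 = 1 := by simp [hS, expQuot_zero]
  have hPc : Continuous P := by fun_prop
  -- It suffices that `S² - P²` is of fifth order, because `S + P` stays away from `0`. Here `S²` is
  -- `expQuot (I * w)`, whose Taylor polynomial of degree `4` exceeds `P²` by `w ^ 5 * T w`.
  have h1 : (fun w : ℝ => S w ^ 2 - P w ^ 2) =O[𝓝[≠] 0] fun w : ℝ => w ^ 5 := by
    have htend : Tendsto (fun w : ℝ => Complex.I * w) (𝓝[≠] 0) (𝓝[≠] 0) := by
      refine tendsto_nhdsWithin_iff.2 ⟨?_, ?_⟩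
      · have : Continuous fun w : ℝ => Complex.I * w := by fun_prop
        simpa using (this.continuousWithinAt (s := {0}ᶜ) (x := 0)).tendsto
      · filter_upwards [self_mem_nhdsWithin] with w hw
        simpa using hw
    have h2 : (fun w : ℝ => expQuot (Complex.I * w) - (1 + (Complex.I * w) / 3
        + (Complex.I * w) ^ 2 / 12 + (Complex.I * w) ^ 3 / 60 + (Complex.I * w) ^ 4 / 360))
        =O[𝓝[≠] 0] fun w : ℝ => w ^ 5 := by
      refine (expQuot_sub_taylor_isBigO.comp_tendsto htend).trans (IsBigO.of_bound 1 ?_)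
      exact Eventually.of_forall fun w => by simp
    set T : ℝ → ℂ := fun w => -(13 / 38880) * Complex.I + (1 / 46656 + 1 / 72900) * w
      + Complex.I / 349920 * w ^ 2
      - 1 / 6718464 * w ^ 3 with hT
    have h3 : (fun w : ℝ => (w : ℂ) ^ 5 * T w) =O[𝓝[≠] 0] fun w : ℝ => w ^ 5 := by
      have hTb : T =O[𝓝[≠] 0] fun _ => (1 : ℝ) :=
        ((show Continuous T by fun_prop).continuousAt (x := 0)).isBigO_one ℝ |>.mono nhdsWithin_le_nhds
      have : (fun w : ℝ => (w : ℂ) ^ 5) =O[𝓝[≠] 0] fun w : ℝ => w ^ 5 :=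
        IsBigO.of_bound 1 (Eventually.of_forall fun w => by simp)
      simpa using this.mul hTb
    refine (h2.add h3).congr_left fun w => ?_
    simp only [hS, hP, hT, cpow_half_sq]
    have hI3 : Complex.I ^ 3 = -Complex.I := Complex.I_pow_three
    have hI4 : Complex.I ^ 4 = 1 := Complex.I_pow_four
    ring_nf
    simp only [Complex.I_sq, hI3, hI4]
    ring
  have h4 : ∀ᶠ w in 𝓝[≠] (0 : ℝ), 1 ≤ ‖S w + P w‖ := by
    have h5 : ContinuousAt (fun w => ‖S w + P w‖) 0 := (hSc.add hPc.continuousAt).norm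
    have h6 : (1 : ℝ) < ‖S 0 + P 0‖ := by rw [hS0]; simp [hP]; norm_num
    exact mem_nhdsWithin_of_mem_nhds ((h5.eventually_const_lt h6).mono fun _ h => h.le)
  have h7 : (fun w : ℝ => S w - P w) =O[𝓝[≠] 0] fun w : ℝ => w ^ 5 := by
    refine IsBigO.trans (IsBigO.of_bound 1 ?_) h1
    filter_upwards [h4] with w hw
    rw [sq_sub_sq, norm_mul, one_mul]
    exact le_mul_of_one_le_left (norm_nonneg _) hw
  have h8 : (fun w : ℝ => (w : ℂ) * (S w - P w)) =O[𝓝[≠] 0] fun w : ℝ => w * w ^ 5 :=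
    (IsBigO.of_bound 1 (Eventually.of_forall fun w => by simp)).mul h7
  have h9 : (fun w : ℝ => (w : ℂ) * (S w - P w)) =O[𝓝 0] fun w : ℝ => w * w ^ 5 := by
    rw [← nhdsNE_sup_pure]
    refine IsBigO.sup h8 (isBigO_pure.2 fun _ => ?_)
    simp
  refine (h9.congr_left fun w => ?_).congr_right fun w => by ring
  rw [hc]; simp only [hP]; ring

/-! ### The change of variable at the saddle point -/

theorem exists_expQuot_ofReal_eq {r : ℝ} : ∃ q : ℝ, 0 < q ∧ expQuot r = q ∧
    r ^ 2 * q = 2 * (Real.exp r - 1 - r) := by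
  rcases eq_or_ne r 0 with rfl | hr
  · exact ⟨1, one_pos, by simp [expQuot_zero], by simp⟩
  · refine ⟨2 * (Real.exp r - 1 - r) / r ^ 2, ?_, ?_, ?_⟩
    · have := Real.add_one_lt_exp hr
      have : 0 < r ^ 2 := by positivity
      apply div_pos <;> linarith
    · rw [expQuot_eq_div (by exact_mod_cast hr)]
      push_cast; rfl
    · field_simp

theorem saddlePsi_ofReal (r : ℝ) : saddlePsi r = saddleU (Real.exp r) := by
  obtain ⟨q, hq, hqe, hqm⟩ := exists_expQuot_ofReal_eq (r := r)
  have h1 : 2 * (Real.exp r - Real.log (Real.exp r) - 1) = r ^ 2 * q := by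
    rw [Real.log_exp, hqm]; ring
  have h2 : saddlePsi r = ((r * Real.sqrt q : ℝ) : ℂ) := by
    rw [saddlePsi, hqe, Real.sqrt_eq_rpow]
    push_cast
    rw [Complex.ofReal_cpow hq.le]
    push_cast; rfl
  rw [h2]
  congr 1
  rcases le_total 0 r with hr | hr
  · rw [saddleU_of_ge (Real.one_le_exp hr), h1, Real.sqrt_mul (sq_nonneg r), Real.sqrt_sq hr]
  · rw [saddleU_of_le (Real.exp_le_one_iff.2 hr), h1, Real.sqrt_mul (sq_nonneg r),
      Real.sqrt_sq_eq_abs, abs_of_nonpos hr]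
    ring

theorem differentiableAt_saddlePsi {z : ℂ} (hz : expQuot z ∈ Complex.slitPlane) :
    DifferentiableAt ℂ saddlePsi z :=
  differentiableAt_id.mul ((differentiable_expQuot z).cpow_const (by exact hz))

theorem hasDerivAt_saddlePsi_zero : HasDerivAt saddlePsi 1 0 := by
  have h1 := (differentiable_expQuot 0).hasDerivAt.cpow_const (c := 1 / 2)
    (by rw [expQuot_zero]; simp)
  have h2 := (hasDerivAt_id (0 : ℂ)).mul h1
  exact h2.congr_deriv (by simp [expQuot_zero])

/-- `saddleU ∘ exp` has a positive derivative `d` everywhere. Differentiating its square gives the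
relation for `d`; at `r = 0` that relation is void and `d = 1` comes from `saddlePsi`. -/
theorem hasDerivAt_saddleU_exp (r : ℝ) :
    ∃ d : ℝ, 0 < d ∧ HasDerivAt (fun r => saddleU (Real.exp r)) d r ∧
      d * saddleU (Real.exp r) = Real.exp r - 1 := by
  obtain ⟨q, hq, hqe, hqm⟩ := exists_expQuot_ofReal_eq (r := r)
  have hd := differentiableAt_saddlePsi (z := r) (by rw [hqe]; simpa using hq)
  have h1 := hd.hasDerivAt.real_of_complex
  simp only [saddlePsi_ofReal, Complex.ofReal_re] at h1
  set d := (deriv saddlePsi r).re with hdd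
  have hsq : ∀ r : ℝ, saddleU (Real.exp r) ^ 2 = 2 * (Real.exp r - 1 - r) := by
    intro r
    have := saddlePsi_sq r
    rw [saddlePsi_ofReal] at this
    exact_mod_cast this
  have h2 := h1.pow 2
  have h3 : HasDerivAt (fun r => 2 * (Real.exp r - 1 - r)) (2 * (Real.exp r - 1)) r :=
    (((Real.hasDerivAt_exp r).sub_const 1).sub (hasDerivAt_id r)).const_mul 2
  have h4 := (h3.congr_of_eventuallyEq (Eventually.of_forall hsq)).unique h2
  have h5 : d * saddleU (Real.exp r) = Real.exp r - 1 := by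
    simp at h4; linarith
  refine ⟨d, ?_, h1, h5⟩
  rcases lt_trichotomy r 0 with hr | rfl | hr
  · have h6 : Real.exp r - 1 < 0 := by linarith [Real.exp_lt_one_iff.2 hr]
    have h7 : saddleU (Real.exp r) ≤ 0 := by
      rw [saddleU_of_le (Real.exp_le_one_iff.2 hr.le)]; simp [Real.sqrt_nonneg]
    by_contra! h
    nlinarith [mul_nonneg_of_nonpos_of_nonpos h h7]
  · rw [hdd, Complex.ofReal_zero, hasDerivAt_saddlePsi_zero.deriv]; simp
  · have h6 : 0 < Real.exp r - 1 := by linarith [Real.add_one_lt_exp hr.ne']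
    have h7 : 0 ≤ saddleU (Real.exp r) := by
      rw [saddleU_of_ge (Real.one_le_exp hr.le)]; simp [Real.sqrt_nonneg]
    by_contra! h
    nlinarith [mul_nonpos_of_nonpos_of_nonneg h h7]

/-- The inverse change of variable in the logarithmic coordinate, `u ↦ log t(u)`. -/
def saddleLog (u : ℝ) : ℝ := Real.log (saddleT u)

theorem exp_saddleLog (u : ℝ) : Real.exp (saddleLog u) = saddleT u :=
  Real.exp_log (saddleT_pos u)

theorem saddleLog_spec (u : ℝ) : u ^ 2 / 2 = Real.exp (saddleLog u) - saddleLog u - 1 := by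
  rw [exp_saddleLog]; exact saddleT_spec u

theorem saddleU_exp_saddleLog (u : ℝ) : saddleU (Real.exp (saddleLog u)) = u := by
  rw [exp_saddleLog]; exact saddleU_saddleT u

theorem strictMono_saddleU_exp : StrictMono fun r => saddleU (Real.exp r) :=
  strictMono_of_deriv_pos fun r => by
    obtain ⟨d, hd, h, -⟩ := hasDerivAt_saddleU_exp r
    rw [h.deriv]; exact hd

theorem saddleLog_saddleU_exp (r : ℝ) : saddleLog (saddleU (Real.exp r)) = r :=
  strictMono_saddleU_exp.injective (saddleU_exp_saddleLog _)

theorem saddleLog_zero : saddleLog 0 = 0 := by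
  simpa [saddleU] using saddleLog_saddleU_exp 0

theorem continuous_saddleLog : Continuous saddleLog := by
  let e := StrictMono.orderIsoOfSurjective _ strictMono_saddleU_exp
    (fun u => ⟨saddleLog u, saddleU_exp_saddleLog u⟩)
  have : saddleLog = e.symm := by
    funext u
    refine e.injective ?_
    rw [e.apply_symm_apply]
    exact saddleU_exp_saddleLog u
  rw [this]; exact e.symm.continuous

theorem hasDerivAt_saddleLog (u : ℝ) : HasDerivAt saddleLog (deriv saddleLog u) u ∧
    0 < deriv saddleLog u ∧ deriv saddleLog u * (Real.exp (saddleLog u) - 1) = u := by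
  obtain ⟨d, hd, h, he⟩ := hasDerivAt_saddleU_exp (saddleLog u)
  rw [saddleU_exp_saddleLog] at he
  have h1 := HasDerivAt.of_local_left_inverse continuous_saddleLog.continuousAt h hd.ne'
    (Eventually.of_forall saddleU_exp_saddleLog)
  rw [h1.deriv]
  refine ⟨h1, inv_pos.2 hd, ?_⟩
  rw [← he, inv_mul_cancel_left₀ hd.ne']

theorem deriv_saddleT (u : ℝ) : deriv saddleT u = saddleT u * deriv saddleLog u := by
  have h := (hasDerivAt_saddleLog u).1.exp
  simp only [exp_saddleLog] at h
  exact h.deriv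

theorem abs_saddleLog_le (u : ℝ) : |saddleLog u| ≤ u ^ 2 / 2 + 1 := by
  have h := saddleLog_spec u
  rw [abs_le]
  constructor
  · linarith [Real.exp_pos (saddleLog u)]
  · rcases le_total 0 (saddleLog u) with h0 | h0
    · have := Real.quadratic_le_exp_of_nonneg h0
      nlinarith [sq_nonneg (saddleLog u - 2)]
    · nlinarith [sq_nonneg u]

theorem abs_div_one_add_le_abs_exp_sub_one (r : ℝ) : |r| / (1 + |r|) ≤ |Real.exp r - 1| := by
  have h0 : 0 < 1 + |r| := by positivity
  rw [div_le_iff₀ h0]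
  rcases le_total 0 r with hr | hr
  · have h := Real.add_one_le_exp r
    rw [abs_of_nonneg hr, abs_of_nonneg (by linarith)]
    nlinarith
  · have h := Real.add_one_le_exp (-r)
    have h1 : Real.exp r * Real.exp (-r) = 1 := by rw [← Real.exp_add]; simp
    have h2 : Real.exp r ≤ 1 := Real.exp_le_one_iff.2 hr
    rw [abs_of_nonpos hr, abs_of_nonpos (by linarith)]
    nlinarith [mul_le_mul_of_nonneg_left h (Real.exp_pos r).le]

/-- The derivative is `u / (exp (saddleLog u) - 1)`. Where `|saddleLog u| ≥ 1` the denominator is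
bounded below; elsewhere both `u` and the denominator are comparable to `saddleLog u`. -/
theorem deriv_saddleLog_le (u : ℝ) : deriv saddleLog u ≤ 4 * (1 + |u|) := by
  obtain ⟨-, hpos, hmul⟩ := hasDerivAt_saddleLog u
  rcases eq_or_ne (saddleLog u) 0 with h0 | h0
  · have hu : u = 0 := by rw [← hmul, h0]; simp
    obtain ⟨d, hd, h, -⟩ := hasDerivAt_saddleU_exp 0
    have h1 := HasDerivAt.of_local_left_inverse (a := 0) continuous_saddleLog.continuousAt
      (by rw [saddleLog_zero]; exact hasDerivAt_saddlePsi_zero.real_of_complex) (by simp)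
      (Eventually.of_forall fun u => by
        simp only [saddlePsi_ofReal, Complex.ofReal_re]; exact saddleU_exp_saddleLog u)
    rw [hu, h1.deriv]; norm_num
  · have hE : 0 < |Real.exp (saddleLog u) - 1| := abs_pos.2 (sub_ne_zero.2 (by simpa using h0))
    have h1 : deriv saddleLog u * |Real.exp (saddleLog u) - 1| = |u| := by
      rw [← abs_of_pos hpos, ← abs_mul, hmul]
    refine le_of_mul_le_mul_right (h1.trans_le ?_) hE
    have h2 := abs_div_one_add_le_abs_exp_sub_one (saddleLog u)
    have hl : 0 < |saddleLog u| := abs_pos.2 h0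
    rcases le_total 1 |saddleLog u| with h3 | h3
    · have h4 : 1 / 2 ≤ |saddleLog u| / (1 + |saddleLog u|) := by
        rw [div_le_div_iff₀ two_pos (by positivity)]; linarith
      nlinarith [abs_nonneg u]
    · have h4 : |saddleLog u| / 2 ≤ |saddleLog u| / (1 + |saddleLog u|) := by
        gcongr; linarith
      have h5 := Real.abs_exp_sub_one_sub_id_le h3
      have h6 := saddleLog_spec u
      have h7 : u ^ 2 ≤ (2 * |saddleLog u|) ^ 2 := by
        rw [mul_pow, sq_abs]
        nlinarith [le_abs_self (Real.exp (saddleLog u) - 1 - saddleLog u), sq_nonneg (saddleLog u)]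
      have h8 : |u| ≤ 2 * |saddleLog u| := abs_le_of_sq_le_sq h7 (by positivity) |> fun h => by
        simpa using h
      nlinarith [abs_nonneg u, mul_nonneg (abs_nonneg u) hE.le]

/-- Near the saddle `saddleLog` is the restriction of a holomorphic function, the local inverse of
`saddlePsi`. -/
theorem exists_holomorphic_saddleLog : ∃ (G : ℂ → ℂ) (δ : ℝ), 0 < δ ∧ G 0 = 0 ∧
    DifferentiableOn ℂ G (Metric.ball 0 δ) ∧ ∀ u : ℝ, |u| < δ → G u = saddleLog u := by
  have hc : ContDiffAt ℂ 1 saddlePsi 0 := by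
    have hs : ∀ᶠ z in 𝓝 (0 : ℂ), expQuot z ∈ Complex.slitPlane :=
      differentiable_expQuot.continuous.continuousAt.eventually_mem
        (Complex.isOpen_slitPlane.mem_nhds (by rw [expQuot_zero]; simp))
    have : AnalyticAt ℂ saddlePsi 0 := by
      rw [Complex.analyticAt_iff_eventually_differentiableAt]
      exact hs.mono fun z hz => differentiableAt_saddlePsi hz
    exact this.contDiffAt
  have hd := hasDerivAt_saddlePsi_zero
  have hf : HasFDerivAt saddlePsi
      ((ContinuousLinearEquiv.unitsEquivAut ℂ (Units.mk0 (1 : ℂ) one_ne_zero) : ℂ ≃L[ℂ] ℂ) : ℂ →L[ℂ] ℂ) 0 :=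
    hd.hasFDerivAt_equiv one_ne_zero
  have h0 : saddlePsi 0 = 0 := by simp [saddlePsi]
  have hG := hc.to_localInverse hf one_ne_zero
  have hG0 := hc.localInverse_apply_image hf one_ne_zero
  have hl : ∀ᶠ z in 𝓝 0, hc.localInverse hf one_ne_zero (saddlePsi z) = z :=
    (hc.hasStrictFDerivAt' hf one_ne_zero).eventually_left_inverse
  set G := hc.localInverse hf one_ne_zero
  rw [h0] at hG hG0
  have hGd : ∀ᶠ z in 𝓝 0, DifferentiableAt ℂ G z :=
    (hG.eventually (by simp)).mono fun z hz => hz.differentiableAt one_ne_zero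
  have ht : Tendsto (fun u : ℝ => (saddleLog u : ℂ)) (𝓝 0) (𝓝 0) := by
    have := (Complex.continuous_ofReal.comp continuous_saddleLog).tendsto 0
    simpa [saddleLog_zero] using! this
  obtain ⟨d1, hd1, h1⟩ := Metric.eventually_nhds_iff.1 hGd
  obtain ⟨d2, hd2, h2⟩ := Metric.eventually_nhds_iff.1 (ht.eventually hl)
  refine ⟨G, min d1 d2, lt_min hd1 hd2, hG0, fun z hz => ?_, fun u hu => ?_⟩
  · exact (h1 (lt_of_lt_of_le hz (min_le_left _ _))).differentiableWithinAt
  · have := h2 (y := u) (by simpa using hu.trans_le (min_le_right _ _))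
    rwa [saddlePsi_ofReal, saddleU_exp_saddleLog] at this

/-! ### The integrand `f` and its regular part `g` -/

theorem iteratedDeriv_ofReal_eq {H : ℂ → ℂ} {g : ℝ → ℂ} {R : ℝ}
    (hH : DifferentiableOn ℂ H (Metric.ball 0 R)) (hg : ∀ u : ℝ, |u| < R → g u = H u) (n : ℕ) :
    ∀ u : ℝ, |u| < R → iteratedDeriv n g u = iteratedDeriv n H u := by
  induction n with
  | zero => simpa using hg
  | succ n ih =>
    intro u hu
    have hmem : (u : ℂ) ∈ Metric.ball (0 : ℂ) R := by simpa using hu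
    have hA : AnalyticAt ℂ (iteratedDeriv n H) u := by
      rw [iteratedDeriv_eq_iterate]
      exact (hH.analyticAt (Metric.isOpen_ball.mem_nhds hmem)).iterated_deriv n
    have h1 := hA.differentiableAt.hasDerivAt.comp_ofReal
    rw [iteratedDeriv_succ, iteratedDeriv_succ]
    refine (h1.congr_of_eventuallyEq ?_).deriv
    filter_upwards [(isOpen_lt continuous_abs continuous_const).mem_nhds hu] with v hv
    exact ih v hv

theorem norm_iteratedDeriv_div_factorial_le {H : ℂ → ℂ} {R ρ M : ℝ} (hρ : 0 < ρ) (hρR : ρ < R)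
    (hH : DifferentiableOn ℂ H (Metric.ball 0 R))
    (hM : ∀ z ∈ Metric.closedBall (0 : ℂ) ρ, ‖H z‖ ≤ M) (n : ℕ) :
    ‖iteratedDeriv n H 0 / (n.factorial : ℂ)‖ ≤ M / ρ ^ n := by
  have hsub : Metric.closedBall (0 : ℂ) ρ ⊆ Metric.ball 0 R := Metric.closedBall_subset_ball hρR
  have hd : DiffContOnCl ℂ H (Metric.ball 0 ρ) := by
    refine DifferentiableOn.diffContOnCl ?_
    rw [closure_ball _ hρ.ne']
    exact hH.mono hsub
  have := Complex.norm_iteratedDeriv_le_of_forall_mem_sphere_norm_le n hρ hd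
    fun z hz => hM z (Metric.sphere_subset_closedBall hz)
  have hf : (0 : ℝ) < n.factorial := by positivity
  rw [norm_div, Complex.norm_natCast, div_le_iff₀ hf]
  refine this.trans_eq ?_
  ring

theorem f_eq (a ν u : ℝ) : f a ν u = Complex.exp ((a + ν) * saddleLog u)
    / (Complex.exp (a * saddleLog u) - Complex.exp (Complex.I * a * omega a))
    * deriv saddleLog u := by
  have h1 : ∀ p : ℝ, saddleT u ^ p = Real.exp (p * saddleLog u) := by
    intro p
    rw [← exp_saddleLog, ← Real.exp_mul, mul_comm]
  have h2 : Real.exp ((a + ν) * saddleLog u) = saddleT u ^ (a + ν - 1) * saddleT u := by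
    rw [h1, ← exp_saddleLog, ← Real.exp_add]; ring_nf
  have h3 : Complex.exp ((a + ν) * saddleLog u) = ((saddleT u ^ (a + ν - 1) * saddleT u : ℝ) : ℂ) := by
    rw [← h2]; push_cast; rfl
  have h4 : Complex.exp (a * saddleLog u) = ((saddleT u ^ a : ℝ) : ℂ) := by
    rw [h1]; push_cast; rfl
  rw [f, h3, h4, deriv_saddleT]
  push_cast
  ring

theorem exp_I_mul_mul_omega {a : ℝ} (ha : a ≠ 0) :
    Complex.exp (Complex.I * a * omega a) = -Complex.exp (-(a * Real.pi * Complex.I)) := by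
  have : Complex.I * a * omega a = Real.pi * Complex.I + -(a * Real.pi * Complex.I) := by
    have ha' : (a : ℂ) ≠ 0 := by exact_mod_cast ha
    rw [omega]; push_cast; field_simp; ring
  rw [this, Complex.exp_add, Complex.exp_pi_mul_I, neg_one_mul]

theorem mul_sin_le_norm_sub_exp {a : ℝ} (ha : 0 < a) (ha1 : a < 1) {x : ℝ} (hx : 0 ≤ x) :
    x * Real.sin (a * Real.pi) ≤ ‖(x : ℂ) - Complex.exp (Complex.I * a * omega a)‖ := by
  have h := le_norm_add_ofReal 0 (-(a * Real.pi)) hx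
  have hs : 0 ≤ Real.sin (a * Real.pi) :=
    Real.sin_nonneg_of_nonneg_of_le_pi (by positivity) (by nlinarith [Real.pi_pos])
  rw [Real.sin_neg, abs_neg, abs_of_nonneg hs] at h
  refine h.trans_eq ?_
  rw [exp_I_mul_mul_omega ha.ne', sub_neg_eq_add, add_comm]
  push_cast
  simp

theorem sin_mul_pi_pos {a : ℝ} (ha : 0 < a) (ha1 : a < 1) : 0 < Real.sin (a * Real.pi) :=
  Real.sin_pos_of_pos_of_lt_pi (by positivity) (by nlinarith [Real.pi_pos])

/-- For `ν < 0` the factor `t ^ ν` grows like `exp (|ν| u² / 2)` as `u → -∞`, so the rate of the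
dominating Gaussian depends on `N`. -/
theorem norm_f_le {a : ℝ} (ha : 0 < a) (ha1 : a < 1) {N ν : ℝ} (hν : |ν| ≤ N) (u : ℝ) :
    ‖f a ν u‖ ≤ 8 * Real.exp N / Real.sin (a * Real.pi) * Real.exp ((N / 2 + 1) * u ^ 2) := by
  have hs := sin_mul_pi_pos ha ha1
  have h1 := mul_sin_le_norm_sub_exp ha ha1 (Real.exp_pos (a * saddleLog u)).le
  have hN : 0 ≤ N := (abs_nonneg _).trans hν
  have hd := (hasDerivAt_saddleLog u).2.1
  have hd2 := deriv_saddleLog_le u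
  rw [f_eq, norm_mul, norm_div]
  have e1 : ‖Complex.exp ((a + ν) * saddleLog u)‖
      = Real.exp (a * saddleLog u) * Real.exp (ν * saddleLog u) := by
    rw [Complex.norm_exp, ← Real.exp_add, add_mul, Complex.add_re, ← Complex.ofReal_mul,
      ← Complex.ofReal_mul, Complex.ofReal_re, Complex.ofReal_re]
  have e2 : Real.exp (ν * saddleLog u) ≤ Real.exp N * Real.exp (N / 2 * u ^ 2) := by
    rw [← Real.exp_add]
    gcongr
    calc ν * saddleLog u ≤ |ν| * |saddleLog u| := by rw [← abs_mul]; exact le_abs_self _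
      _ ≤ N * (u ^ 2 / 2 + 1) := by gcongr; exact abs_saddleLog_le u
      _ = _ := by ring
  have e3 : 1 + |u| ≤ 2 * Real.exp (u ^ 2) := by
    have := Real.add_one_le_exp (u ^ 2)
    nlinarith [sq_abs u, sq_nonneg (|u| - 1)]
  have e4 : ‖((deriv saddleLog u : ℝ) : ℂ)‖ ≤ 8 * Real.exp (u ^ 2) := by
    rw [Complex.norm_real, Real.norm_of_nonneg hd.le]; linarith
  have e5 : ‖Complex.exp ((a + ν) * saddleLog u)‖
      / ‖Complex.exp (a * saddleLog u) - Complex.exp (Complex.I * a * omega a)‖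
      ≤ Real.exp N * Real.exp (N / 2 * u ^ 2) / Real.sin (a * Real.pi) := by
    rw [e1]
    push_cast at h1
    have hpos : 0 < Real.exp (a * saddleLog u) * Real.sin (a * Real.pi) := by positivity
    calc _ ≤ Real.exp (a * saddleLog u) * (Real.exp N * Real.exp (N / 2 * u ^ 2))
          / (Real.exp (a * saddleLog u) * Real.sin (a * Real.pi)) := by gcongr
      _ = _ := by rw [mul_div_mul_left _ _ (Real.exp_pos _).ne']
  calc _ ≤ Real.exp N * Real.exp (N / 2 * u ^ 2) / Real.sin (a * Real.pi)
        * (8 * Real.exp (u ^ 2)) := by gcongr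
    _ = _ := by
      rw [show (N / 2 + 1) * u ^ 2 = N / 2 * u ^ 2 + u ^ 2 by ring, Real.exp_add]; ring

theorem measurable_f (a ν : ℝ) : Measurable (f a ν) := by
  have h : f a ν = fun u => Complex.exp ((a + ν) * saddleLog u)
    / (Complex.exp (a * saddleLog u) - Complex.exp (Complex.I * a * omega a))
    * deriv saddleLog u := funext (f_eq a ν)
  rw [h]
  have h1 := continuous_saddleLog.measurable
  have h2 := measurable_deriv saddleLog
  fun_prop

theorem omega_pos {a : ℝ} (ha : 0 < a) (ha1 : a < 1) : 0 < omega a :=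
  div_pos (mul_pos Real.pi_pos (by linarith)) ha

theorem omega_lt {a : ℝ} (ha : 1 / 3 < a) : omega a < 2 * Real.pi := by
  rw [omega, div_lt_iff₀ (by linarith)]
  nlinarith [Real.pi_pos]

theorem residueA_ne_zero {a : ℝ} (ha : a ≠ 0) (ν : ℝ) : residueA a ν ≠ 0 :=
  div_ne_zero (Complex.exp_ne_zero _) (by exact_mod_cast ha)

theorem norm_residueA {a : ℝ} (ha : 0 < a) (ν : ℝ) : ‖residueA a ν‖ = 1 / a := by
  rw [residueA, norm_div, Complex.norm_real, Real.norm_of_nonneg ha.le, mul_assoc, mul_comm,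
    ← Complex.ofReal_mul, Complex.norm_exp_ofReal_mul_I]

theorem re_cRoot_omega_pos {a : ℝ} (ha : 1 / 3 < a) (ha1 : a < 1) : 0 < (cRoot (omega a)).re :=
  re_cRoot_pos (omega_pos (by linarith) ha1) (omega_lt ha)

theorem norm_one_div_sub_poleU_le {a : ℝ} (ha : 1 / 3 < a) (ha1 : a < 1) (u : ℝ) :
    ‖1 / ((u : ℂ) - poleU a)‖ ≤ 1 / (cRoot (omega a)).re := by
  have hc := re_cRoot_omega_pos ha ha1
  rw [norm_div, norm_one]
  gcongr
  have := Complex.abs_im_le_norm ((u : ℂ) - poleU a)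
  simpa [poleU, abs_of_pos hc] using this

theorem f_eq_residueA_mul {a : ℝ} (ha : a ≠ 0) (ν u : ℝ) :
    f a ν u = residueA a ν * (1 / ((u : ℂ) - poleU a) + g a ν u) := by
  rw [g, add_sub_cancel, mul_div_cancel₀ _ (residueA_ne_zero ha ν)]

theorem measurable_g (a ν : ℝ) : Measurable (g a ν) := by
  have := measurable_f a ν
  unfold g
  fun_prop

theorem exists_norm_g_le {a : ℝ} (ha : 1 / 3 < a) (ha1 : a < 1) (N : ℝ) : ∃ C, 0 ≤ C ∧
    ∀ ν, |ν| ≤ N → ∀ u, ‖g a ν u‖ ≤ C * Real.exp ((N / 2 + 1) * u ^ 2) := by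
  have ha0 : 0 < a := by linarith
  have hs := sin_mul_pi_pos ha0 ha1
  have hc := re_cRoot_omega_pos ha ha1
  refine ⟨8 * Real.exp N / Real.sin (a * Real.pi) * a + 1 / (cRoot (omega a)).re, by positivity,
    fun ν hν u => ?_⟩
  have hN : 0 ≤ N := (abs_nonneg _).trans hν
  rw [g, add_mul]
  refine (norm_sub_le _ _).trans (add_le_add ?_ ?_)
  · rw [norm_div, norm_residueA ha0, div_div_eq_mul_div, div_one]
    have := mul_le_mul_of_nonneg_right (norm_f_le ha0 ha1 hν u) ha0.le
    linarith
  · refine (norm_one_div_sub_poleU_le ha ha1 u).trans (le_mul_of_one_le_right (by positivity) ?_)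
    exact Real.one_le_exp (by positivity)

/-- Near `0` the function `g a ν` is the restriction of a function holomorphic on a disc that does not
depend on `ν`, and bounded on a smaller one uniformly for `|ν| ≤ N`. Cauchy's estimates then bound
its Taylor coefficients. -/
theorem exists_hasSum_coeffB {a : ℝ} (ha : 1 / 3 < a) (ha1 : a < 1) : ∃ ρ : ℝ, 0 < ρ ∧
    (∀ ν u : ℝ, |u| < ρ → HasSum (fun r : ℕ => coeffB a ν r * (u : ℂ) ^ r) (g a ν u)) ∧
    ∀ N : ℝ, ∃ M : ℝ, 0 ≤ M ∧ ∀ ν, |ν| ≤ N → ∀ r, ‖coeffB a ν r‖ ≤ M / ρ ^ r := by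
  have ha0 : 0 < a := by linarith
  have hs := sin_mul_pi_pos ha0 ha1
  have hc := re_cRoot_omega_pos ha ha1
  obtain ⟨G, δ, hδ, hG0, hG, hGu⟩ := exists_holomorphic_saddleLog
  have hGc : ContinuousAt G 0 :=
    (hG.differentiableAt (Metric.ball_mem_nhds 0 hδ)).continuousAt
  have hden : ∀ᶠ z in 𝓝 (0 : ℂ),
      Complex.exp (a * G z) - Complex.exp (Complex.I * a * omega a) ≠ 0 := by
    have h1 : ContinuousAt (fun z => Complex.exp (a * G z)
      - Complex.exp (Complex.I * a * omega a)) 0 := by fun_prop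
    refine h1.eventually_ne ?_
    have h2 := mul_sin_le_norm_sub_exp ha0 ha1 zero_le_one
    rw [hG0, mul_zero, Complex.exp_zero]
    rw [one_mul, Complex.ofReal_one] at h2
    exact norm_pos_iff.1 (hs.trans_le h2)
  have hpole : ∀ᶠ z in 𝓝 (0 : ℂ), z - poleU a ≠ 0 := by
    have h1 : ContinuousAt (fun z : ℂ => z - poleU a) 0 := by fun_prop
    refine h1.eventually_ne fun h => ?_
    have := congrArg Complex.im h
    simp [poleU] at this
    exact hc.ne' this
  obtain ⟨d, hd, hd'⟩ := Metric.eventually_nhds_iff.1 (hden.and hpole)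
  set R := min δ d with hR
  have hR0 : 0 < R := lt_min hδ hd
  have hne : ∀ z ∈ Metric.ball (0 : ℂ) R,
      Complex.exp (a * G z) - Complex.exp (Complex.I * a * omega a) ≠ 0 ∧ z - poleU a ≠ 0 :=
    fun z hz => hd' (lt_of_lt_of_le hz (min_le_right _ _))
  have hGR : DifferentiableOn ℂ G (Metric.ball 0 R) := hG.mono (Metric.ball_subset_ball (min_le_left _ _))
  have hG' : DifferentiableOn ℂ (deriv G) (Metric.ball 0 R) := hGR.deriv Metric.isOpen_ball
  set H : ℝ → ℂ → ℂ := fun ν z => Complex.exp ((a + ν) * G z)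
    / (Complex.exp (a * G z) - Complex.exp (Complex.I * a * omega a)) * deriv G z / residueA a ν
      - 1 / (z - poleU a) with hH
  have hHd : ∀ ν, DifferentiableOn ℂ (H ν) (Metric.ball 0 R) := by
    intro ν
    refine DifferentiableOn.sub (DifferentiableOn.div_const (DifferentiableOn.mul
      (DifferentiableOn.div (by fun_prop) (by fun_prop) fun z hz => (hne z hz).1) hG') _)
      (DifferentiableOn.div (by fun_prop) (by fun_prop) fun z hz => (hne z hz).2)
  have hgH : ∀ ν u : ℝ, |u| < R → g a ν u = H ν u := by
    intro ν u hu
    have hu' : |u| < δ := hu.trans_le (min_le_left _ _)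
    have hder : deriv G u = deriv saddleLog u := by
      have h1 : HasDerivAt G (deriv G u) u :=
        (hGR.differentiableAt (Metric.isOpen_ball.mem_nhds (by simpa using hu))).hasDerivAt
      have h2 := (hasDerivAt_saddleLog u).1.ofReal_comp
      refine h1.comp_ofReal.unique (h2.congr_of_eventuallyEq ?_)
      filter_upwards [(isOpen_lt continuous_abs continuous_const).mem_nhds hu'] with v hv
      exact hGu v hv
    rw [g, f_eq]
    simp only [hH]
    rw [hder, hGu u hu']
  have hρR : R / 2 < R := half_lt_self hR0
  have hcoeff : ∀ ν r, coeffB a ν r = iteratedDeriv r (H ν) 0 / (r.factorial : ℂ) := by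
    intro ν r
    rw [coeffB, iteratedDeriv_ofReal_eq (hHd ν) (hgH ν) r 0 (by simpa using hR0)]
    simp
  refine ⟨R / 2, half_pos hR0, fun ν u hu => ?_, fun N => ?_⟩
  · have h := Complex.hasSum_taylorSeries_on_ball (hHd ν) (z := u) (by simpa using hu.trans hρR)
    rw [← hgH ν u (hu.trans hρR)] at h
    refine h.congr_fun fun r => ?_
    rw [hcoeff, sub_zero, smul_eq_mul, smul_eq_mul]
    ring
  · have hsub : Metric.closedBall (0 : ℂ) (R / 2) ⊆ Metric.ball 0 R :=
      Metric.closedBall_subset_ball hρR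
    have hcont : ContinuousOn (fun p : ℝ × ℂ => H p.1 p.2)
        (Icc (-N) N ×ˢ Metric.closedBall 0 (R / 2)) := by
      have m : MapsTo (fun p : ℝ × ℂ => p.2) (Icc (-N) N ×ˢ Metric.closedBall 0 (R / 2))
        (Metric.ball 0 R) := fun p hp => hsub hp.2
      have c1 : ContinuousOn (fun p : ℝ × ℂ => G p.2) (Icc (-N) N ×ˢ Metric.closedBall 0 (R / 2)) :=
        hGR.continuousOn.comp continuousOn_snd m
      have c2 : ContinuousOn (fun p : ℝ × ℂ => deriv G p.2)
        (Icc (-N) N ×ˢ Metric.closedBall 0 (R / 2)) := hG'.continuousOn.comp continuousOn_snd m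
      have c0 : ContinuousOn (fun p : ℝ × ℂ => (p.1 : ℂ))
        (Icc (-N) N ×ˢ Metric.closedBall 0 (R / 2)) :=
        (Complex.continuous_ofReal.comp continuous_fst).continuousOn
      have c3 : Continuous fun p : ℝ × ℂ => residueA a p.1 := by unfold residueA; fun_prop
      refine ContinuousOn.sub (ContinuousOn.div (ContinuousOn.mul
        (ContinuousOn.div ((c0.const_add _).mul c1).cexp
          ((continuousOn_const.mul c1).cexp.sub continuousOn_const)
          fun p hp => (hne _ (m hp)).1) c2)
        c3.continuousOn fun p _ => residueA_ne_zero ha0.ne' p.1)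
        (ContinuousOn.div (by fun_prop) (by fun_prop) fun p hp => (hne _ (m hp)).2)
    obtain ⟨M, hM⟩ := (isCompact_Icc.prod (isCompact_closedBall (0 : ℂ) (R / 2))).exists_bound_of_continuousOn hcont
    refine ⟨|M|, abs_nonneg _, fun ν hν r => ?_⟩
    rw [hcoeff]
    exact norm_iteratedDeriv_div_factorial_le (half_pos hR0) hρR (hHd ν)
      (fun z hz => (hM (ν, z) ⟨abs_le.1 hν, hz⟩).trans (le_abs_self M)) r

/-! ### Watson's lemma -/

theorem integrable_pow_mul_gaussian {b : ℝ} (hb : 0 < b) (n : ℕ) :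
    Integrable fun u : ℝ => Real.exp (-(b * u ^ 2)) * u ^ n := by
  refine (integrable_rpow_mul_exp_neg_mul_sq hb (s := n) (by linarith [n.cast_nonneg (α := ℝ)])).congr
    (Eventually.of_forall fun u => ?_)
  simp only [Real.rpow_natCast, neg_mul, mul_comm]

theorem integral_pow_even_mul_gaussian {b : ℝ} (hb : 0 < b) (k : ℕ) :
    ∫ u : ℝ, Real.exp (-(b * u ^ 2)) * u ^ (2 * k)
      = b ^ (-((k : ℝ) + 1 / 2)) * Real.Gamma (k + 1 / 2) := by
  have h1 := integral_comp_abs (f := fun u : ℝ => Real.exp (-(b * u ^ 2)) * u ^ (2 * k))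
  have h2 := integral_rpow_mul_exp_neg_mul_rpow (p := 2) (q := ((2 * k : ℕ) : ℝ)) (b := b) two_pos
    (by linarith [(2 * k).cast_nonneg (α := ℝ)]) hb
  simp only [Even.pow_abs (even_two_mul k), sq_abs] at h1
  rw [h1]
  have h3 : ∀ u : ℝ, Real.exp (-(b * u ^ 2)) * u ^ (2 * k)
      = u ^ (((2 * k : ℕ) : ℝ)) * Real.exp (-b * u ^ (2 : ℝ)) := by
    intro u
    rw [Real.rpow_natCast, Real.rpow_two, neg_mul, mul_comm]
  simp only [h3]
  rw [h2]
  have e1 : -(((2 * k : ℕ) : ℝ) + 1) / 2 = -((k : ℝ) + 1 / 2) := by push_cast; ring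
  have e2 : (((2 * k : ℕ) : ℝ) + 1) / 2 = (k : ℝ) + 1 / 2 := by push_cast; ring
  rw [e1, e2]
  ring

theorem integral_pow_odd_mul_gaussian (b : ℝ) (k : ℕ) :
    ∫ u : ℝ, Real.exp (-(b * u ^ 2)) * u ^ (2 * k + 1) = 0 := by
  have h := integral_neg_eq_self (fun u : ℝ => Real.exp (-(b * u ^ 2)) * u ^ (2 * k + 1)) volume
  simp only [neg_sq, Odd.neg_pow (odd_two_mul_add_one k), mul_neg] at h
  rw [integral_neg] at h
  linarith

theorem Gamma_nat_add_half_eq (k : ℕ) : ((Real.Gamma (k + 1 / 2) : ℝ) : ℂ)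
    = Real.sqrt Real.pi * (ascPochhammer ℂ k).eval (1 / 2) := by
  induction k with
  | zero => simp [← Real.Gamma_one_half_eq]
  | succ k ih =>
    have h : ((k + 1 : ℕ) : ℝ) + 1 / 2 = (k + 1 / 2) + 1 := by push_cast; ring
    rw [h, Real.Gamma_add_one (by positivity), ascPochhammer_succ_eval, Complex.ofReal_mul, ih]
    push_cast
    ring

theorem integral_gaussian_moment {X : ℝ} (hX : 0 < X) (k : ℕ) :
    ((∫ u : ℝ, Real.exp (-(X / 2 * u ^ 2)) * u ^ (2 * k) : ℝ) : ℂ)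
      = 2 * Real.pi / (Real.sqrt (2 * Real.pi * X) : ℝ) *
        ((ascPochhammer ℂ k).eval (1 / 2) * ((X : ℂ) / 2) ^ (-(k : ℤ))) := by
  have hX2 : 0 < X / 2 := by positivity
  have hpi := Real.pi_pos
  rw [integral_pow_even_mul_gaussian hX2, Complex.ofReal_mul, Gamma_nat_add_half_eq]
  have h1 : (X / 2) ^ (-((k : ℝ) + 1 / 2)) * Real.sqrt Real.pi
      = 2 * Real.pi / Real.sqrt (2 * Real.pi * X) * (X / 2) ^ (-(k : ℤ)) := by
    have e1 : (X / 2) ^ (-((k : ℝ) + 1 / 2)) = (X / 2) ^ (-(k : ℤ)) * (Real.sqrt (X / 2))⁻¹ := by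
      rw [neg_add, Real.rpow_add hX2, Real.rpow_neg hX2.le (1 / 2), ← Real.sqrt_eq_rpow,
        ← Real.rpow_intCast]
      push_cast; rfl
    have e2 : Real.sqrt (2 * Real.pi * X) = 2 * (Real.sqrt (X / 2) * Real.sqrt Real.pi) := by
      rw [← Real.sqrt_mul hX2.le, show 2 * Real.pi * X = 2 ^ 2 * (X / 2 * Real.pi) by ring,
        Real.sqrt_mul (by positivity), Real.sqrt_sq two_pos.le]
    have e3 : Real.sqrt Real.pi * Real.sqrt Real.pi = Real.pi := Real.mul_self_sqrt hpi.le
    have e4 : 0 < Real.sqrt Real.pi := Real.sqrt_pos.2 hpi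
    have e5 : 0 < Real.sqrt (X / 2) := Real.sqrt_pos.2 hX2
    rw [e1, e2]
    rw [mul_assoc, mul_comm (2 * Real.pi / _)]
    congr 1
    field_simp
    linear_combination e3
  have h2 := congrArg (fun y : ℝ => (y : ℂ)) h1
  simp only [Complex.ofReal_mul, Complex.ofReal_div, Complex.ofReal_zpow, Complex.ofReal_ofNat] at h2
  rw [← mul_assoc, h2]
  ring

/-- A function with a Taylor expansion at `0` and at most Gaussian growth satisfies a global Taylor
estimate. For `|u| ≤ ρ / 2` the tail of the series is geometric; beyond, `(2 |u| / ρ) ^ n ≥ 1` absorbs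
the function and every term of the polynomial. -/
theorem norm_sub_taylor_le {g : ℝ → ℂ} {B : ℕ → ℂ} {ρ M C β : ℝ} (hρ : 0 < ρ) (hM : 0 ≤ M)
    (hC : 0 ≤ C) (hβ : 0 ≤ β) (hB : ∀ r, ‖B r‖ ≤ M / ρ ^ r)
    (hsum : ∀ u : ℝ, |u| < ρ → HasSum (fun r : ℕ => B r * (u : ℂ) ^ r) (g u))
    (hg : ∀ u, ‖g u‖ ≤ C * Real.exp (β * u ^ 2)) (n : ℕ) (u : ℝ) :
    ‖g u - ∑ r ∈ Finset.range n, B r * (u : ℂ) ^ r‖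
      ≤ (2 * M + (C + n * M) * 2 ^ n) / ρ ^ n * (|u| ^ n * Real.exp (β * u ^ 2)) := by
  have hexp : 1 ≤ Real.exp (β * u ^ 2) := Real.one_le_exp (by positivity)
  set t := |u| / ρ with ht
  have ht0 : 0 ≤ t := by positivity
  have hterm : ∀ r, ‖B r * (u : ℂ) ^ r‖ ≤ M * t ^ r := by
    intro r
    rw [norm_mul, norm_pow, Complex.norm_real, Real.norm_eq_abs, ht, div_pow]
    calc _ ≤ M / ρ ^ r * |u| ^ r := by gcongr; exact hB r
      _ = _ := by ring
  have hgoal : (2 * M + (C + n * M) * 2 ^ n) / ρ ^ n * (|u| ^ n * Real.exp (β * u ^ 2))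
      = 2 * M * t ^ n * Real.exp (β * u ^ 2) + (C + n * M) * (2 * t) ^ n * Real.exp (β * u ^ 2) := by
    rw [ht, mul_pow, div_pow]; field_simp
  rw [hgoal]
  rcases le_total t (1 / 2) with h | h
  · have hu : |u| < ρ := by
      rw [ht, div_le_iff₀ hρ] at h; linarith
    have h1 := (hasSum_nat_add_iff' n).2 (hsum u hu)
    have h2 : HasSum (fun r => M * t ^ n * t ^ r) (M * t ^ n * (1 - t)⁻¹) :=
      (hasSum_geometric_of_lt_one ht0 (by linarith)).mul_left _
    have h3 := h1.norm_le_of_bounded h2 fun r => (hterm (r + n)).trans_eq (by ring)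
    have h4 : (1 - t)⁻¹ ≤ 2 := by
      rw [inv_le_comm₀ (by linarith) two_pos]; linarith
    calc _ ≤ M * t ^ n * (1 - t)⁻¹ := h3
      _ ≤ M * t ^ n * 2 := by gcongr
      _ ≤ 2 * M * t ^ n * Real.exp (β * u ^ 2) := by
        rw [mul_comm, ← mul_assoc]
        exact le_mul_of_one_le_right (by positivity) hexp
      _ ≤ _ := le_add_of_nonneg_right (by positivity)
  · have h2t : 1 ≤ 2 * t := by linarith
    have h1 : ‖∑ r ∈ Finset.range n, B r * (u : ℂ) ^ r‖ ≤ n * M * (2 * t) ^ n := by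
      refine (norm_sum_le_of_le _ (n := fun _ => M * (2 * t) ^ n) fun r hr => ?_).trans_eq (by
        simp [mul_assoc])
      refine (hterm r).trans ?_
      gcongr
      calc t ^ r ≤ (2 * t) ^ r := by gcongr; linarith
        _ ≤ (2 * t) ^ n := pow_le_pow_right₀ h2t (Finset.mem_range.1 hr).le
    have h2 : ‖g u‖ ≤ C * (2 * t) ^ n * Real.exp (β * u ^ 2) := by
      refine (hg u).trans ?_
      gcongr
      exact le_mul_of_one_le_right hC (one_le_pow₀ h2t)
    have h3 : n * M * (2 * t) ^ n ≤ n * M * (2 * t) ^ n * Real.exp (β * u ^ 2) :=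
      le_mul_of_one_le_right (by positivity) hexp
    have h4 : 0 ≤ 2 * M * t ^ n * Real.exp (β * u ^ 2) := by positivity
    refine (norm_sub_le _ _).trans ?_
    linarith

theorem sum_range_two_mul {E : Type*} [AddCommMonoid E] (F : ℕ → E) (hF : ∀ k, F (2 * k + 1) = 0)
    (K : ℕ) : ∑ r ∈ Finset.range (2 * K), F r = ∑ k ∈ Finset.range K, F (2 * k) := by
  induction K with
  | zero => simp
  | succ K ih =>
    rw [show 2 * (K + 1) = 2 * K + 1 + 1 by ring, Finset.sum_range_succ, Finset.sum_range_succ, ih,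
      hF, add_zero, Finset.sum_range_succ]

/-- **Watson's lemma** with an explicit error term; the odd powers integrate to `0`. -/
theorem norm_integral_gaussian_sub_le {g : ℝ → ℂ} {B : ℕ → ℂ} {C β : ℝ} (K : ℕ)
    (hgm : AEStronglyMeasurable g)
    (hg : ∀ u : ℝ, ‖g u - ∑ r ∈ Finset.range (2 * K), B r * (u : ℂ) ^ r‖
      ≤ C * (u ^ (2 * K) * Real.exp (β * u ^ 2))) {X : ℝ} (hX0 : 0 < X) (hX : 4 * β ≤ X) :
    ‖(∫ u : ℝ, (Real.exp (-(X / 2 * u ^ 2)) : ℂ) * g u) - ∑ k ∈ Finset.range K, B (2 * k) *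
        ((∫ u : ℝ, Real.exp (-(X / 2 * u ^ 2)) * u ^ (2 * k) : ℝ) : ℂ)‖
      ≤ C * ((X / 4) ^ (-((K : ℝ) + 1 / 2)) * Real.Gamma (K + 1 / 2)) := by
  have hi := fun n => integrable_pow_mul_gaussian (half_pos hX0) n
  have hi4 := integrable_pow_mul_gaussian (b := X / 4) (by positivity) (2 * K)
  have hterm : ∀ r ∈ Finset.range (2 * K), Integrable fun u : ℝ =>
      B r * ((Real.exp (-(X / 2 * u ^ 2)) * u ^ r : ℝ) : ℂ) := fun r _ => (hi r).ofReal.const_mul _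
  have hC : 0 ≤ C := by
    have := (norm_nonneg _).trans (hg 1)
    have h2 : 0 < (1 : ℝ) ^ (2 * K) * Real.exp (β * 1 ^ 2) := by positivity
    exact nonneg_of_mul_nonneg_left this h2
  have hbound : ∀ u : ℝ, ‖(Real.exp (-(X / 2 * u ^ 2)) : ℂ)
      * (g u - ∑ r ∈ Finset.range (2 * K), B r * (u : ℂ) ^ r)‖
      ≤ C * (Real.exp (-(X / 4 * u ^ 2)) * u ^ (2 * K)) := by
    intro u
    have hp : 0 ≤ u ^ (2 * K) := (even_two_mul K).pow_nonneg u
    rw [norm_mul, Complex.norm_real, Real.norm_of_nonneg (Real.exp_pos _).le]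
    calc _ ≤ Real.exp (-(X / 2 * u ^ 2)) * (C * (u ^ (2 * K) * Real.exp (β * u ^ 2))) := by
          gcongr; exact hg u
      _ = C * (Real.exp (-(X / 2 * u ^ 2) + β * u ^ 2) * u ^ (2 * K)) := by
          rw [Real.exp_add]; ring
      _ ≤ _ := by
          gcongr
          nlinarith [sq_nonneg u]
  have hmain : Integrable fun u : ℝ => (Real.exp (-(X / 2 * u ^ 2)) : ℂ)
      * (g u - ∑ r ∈ Finset.range (2 * K), B r * (u : ℂ) ^ r) := by
    refine (hi4.const_mul C).mono' ?_ (Eventually.of_forall hbound)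
    refine AEStronglyMeasurable.mul (Continuous.aestronglyMeasurable (by fun_prop))
      (hgm.sub (Continuous.aestronglyMeasurable (by fun_prop)))
  have hsplit : ∫ u : ℝ, (Real.exp (-(X / 2 * u ^ 2)) : ℂ) * g u
      = (∫ u : ℝ, (Real.exp (-(X / 2 * u ^ 2)) : ℂ)
        * (g u - ∑ r ∈ Finset.range (2 * K), B r * (u : ℂ) ^ r))
        + ∑ k ∈ Finset.range K, B (2 * k) *
          ((∫ u : ℝ, Real.exp (-(X / 2 * u ^ 2)) * u ^ (2 * k) : ℝ) : ℂ) := by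
    have h1 : ∑ k ∈ Finset.range K, B (2 * k) *
          ((∫ u : ℝ, Real.exp (-(X / 2 * u ^ 2)) * u ^ (2 * k) : ℝ) : ℂ)
        = ∫ u : ℝ, ∑ r ∈ Finset.range (2 * K),
          B r * ((Real.exp (-(X / 2 * u ^ 2)) * u ^ r : ℝ) : ℂ) := by
      rw [integral_finsetSum _ hterm]
      simp only [integral_const_mul, integral_complex_ofReal]
      rw [sum_range_two_mul]
      intro k
      rw [integral_pow_odd_mul_gaussian]; simp
    rw [h1, ← integral_add hmain (integrable_finsetSum _ hterm)]
    congr 1 with u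
    rw [mul_sub, Finset.mul_sum]
    have : ∀ r, (Real.exp (-(X / 2 * u ^ 2)) : ℂ) * (B r * (u : ℂ) ^ r)
        = B r * ((Real.exp (-(X / 2 * u ^ 2)) * u ^ r : ℝ) : ℂ) := by
      intro r; push_cast; ring
    simp only [this]
    ring
  rw [hsplit, add_sub_cancel_right]
  refine (norm_integral_le_of_norm_le (hi4.const_mul C) (Eventually.of_forall hbound)).trans_eq ?_
  rw [integral_const_mul, integral_pow_even_mul_gaussian (by positivity)]

/-! ### The remainder at optimal truncation -/

/-- The integrand of the remainder on the upper side of the cut, under `s = X t(u)`. With `a M = X + ν`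
the powers of `t` combine with the exponential to `exp (-X (t - log t)) = exp (-X - X u² / 2)`. -/
theorem zpow_neg_mul_remainderKernel {a ν x X : ℝ} {M : ℕ} (ha : 0 < a) (ha1 : a < 1) (hX : 0 < X)
    (hx : x = X ^ a) (hM : a * M = X + ν) (u : ℝ) :
    (-(x : ℂ)) ^ (-(M : ℤ)) * ((deriv saddleLog u : ℝ) *
        remainderKernel M a x (((Real.log X + saddleLog u : ℝ) : ℂ) + Real.pi * Complex.I))
      = Complex.exp (-X - Complex.I * omega a * X) * Complex.exp (-(Complex.I * ν * omega a))
        * ((Real.exp (-(X / 2 * u ^ 2)) : ℂ) * f a ν u) := by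
  have hx0 : 0 < x := hx ▸ Real.rpow_pos_of_pos hX a
  have hx0' : (x : ℂ) ≠ 0 := by exact_mod_cast hx0.ne'
  have hD := exp_I_mul_mul_omega ha.ne'
  have hne : Complex.exp (a * saddleLog u) - Complex.exp (Complex.I * a * omega a) ≠ 0 := by
    have h1 := mul_sin_le_norm_sub_exp ha ha1 (Real.exp_pos (a * saddleLog u)).le
    have h2 := mul_pos (Real.exp_pos (a * saddleLog u)) (sin_mul_pi_pos ha ha1)
    push_cast at h1
    exact norm_pos_iff.1 (h2.trans_le h1)
  have hD0 := Complex.exp_ne_zero (Complex.I * a * omega a)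
  have e1 : Complex.exp (((Real.log X + saddleLog u : ℝ) : ℂ) + Real.pi * Complex.I)
      = -(X * Complex.exp (saddleLog u)) := by
    rw [exp_add_pi, Real.exp_add, Real.exp_log hX]; push_cast; rfl
  have e2 : Complex.exp (a * (((Real.log X + saddleLog u : ℝ) : ℂ) + Real.pi * Complex.I))
      = -(x * Complex.exp (a * saddleLog u) / Complex.exp (Complex.I * a * omega a)) := by
    have h1 : (a : ℂ) * (((Real.log X + saddleLog u : ℝ) : ℂ) + Real.pi * Complex.I)
        = ((Real.log X * a : ℝ) : ℂ) + a * saddleLog u + a * Real.pi * Complex.I := by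
      push_cast; ring
    have h2 : x = Real.exp (Real.log X * a) := by rw [hx, Real.rpow_def_of_pos hX]
    rw [h1, Complex.exp_add, Complex.exp_add, ← Complex.ofReal_exp, ← h2, hD, Complex.exp_neg,
      div_neg, neg_neg, div_inv_eq_mul]
  have e3 : Complex.exp (a * (M + 1) * (((Real.log X + saddleLog u : ℝ) : ℂ) + Real.pi * Complex.I))
      = (-(x * Complex.exp (a * saddleLog u) / Complex.exp (Complex.I * a * omega a))) ^ (M + 1) := by
    rw [← e2, ← Complex.exp_nat_mul]
    push_cast; ring_nf
  rw [remainderKernel, e1, e2, e3, f_eq]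
  have e4 : Complex.exp (-(X * Complex.exp (saddleLog u))) * Complex.exp (a * saddleLog u) ^ (M + 1)
      / Complex.exp (Complex.I * a * omega a) ^ M
      = Complex.exp (-X - Complex.I * omega a * X) * Complex.exp (-(Complex.I * ν * omega a))
        * ((Real.exp (-(X / 2 * u ^ 2)) : ℂ) * Complex.exp ((a + ν) * saddleLog u)) := by
    have hMc : (a : ℂ) * M = X + ν := by exact_mod_cast hM
    have hs : (u : ℂ) ^ 2 / 2 = Complex.exp (saddleLog u) - saddleLog u - 1 := by
      exact_mod_cast congrArg (fun y : ℝ => (y : ℂ)) (saddleLog_spec u)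
    rw [← Complex.exp_nat_mul, ← Complex.exp_nat_mul, Complex.ofReal_exp, ← Complex.exp_add,
      ← Complex.exp_sub, ← Complex.exp_add, ← Complex.exp_add, ← Complex.exp_add]
    congr 1
    push_cast
    linear_combination (saddleLog u - Complex.I * omega a) * hMc + X * hs
  have e5 : -(x * Complex.exp (a * saddleLog u) / Complex.exp (Complex.I * a * omega a)) + x
      = -x * (Complex.exp (a * saddleLog u) - Complex.exp (Complex.I * a * omega a))
        / Complex.exp (Complex.I * a * omega a) := by
    field_simp; ring
  rw [e5]
  have hxn : (-(x : ℂ)) ≠ 0 := neg_ne_zero.2 hx0'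
  have e6 : -(x * Complex.exp (a * saddleLog u) / Complex.exp (Complex.I * a * omega a))
      = -x * (Complex.exp (a * saddleLog u) / Complex.exp (Complex.I * a * omega a)) := by ring
  rw [e6, mul_pow, div_pow, zpow_neg, zpow_natCast]
  generalize (-(x : ℂ)) = y at hxn
  calc _ = (Complex.exp (-(X * Complex.exp (saddleLog u))) * Complex.exp (a * saddleLog u) ^ (M + 1)
        / Complex.exp (Complex.I * a * omega a) ^ M)
        / (Complex.exp (a * saddleLog u) - Complex.exp (Complex.I * a * omega a))
        * deriv saddleLog u := by
        generalize Complex.exp (Complex.I * a * omega a) = D at *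
        generalize Complex.exp (a * saddleLog u) = E at *
        field_simp
        ring
    _ = _ := by rw [e4]; ring

/-- The exact representation of the remainder as a Gaussian integral of `f`. -/
theorem remainder_eq_im {a ν x X : ℝ} {M : ℕ} (ha : 0 < a) (ha1 : a < 1) (hX : 0 < X)
    (hx : x = X ^ a) (hM : a * M = X + ν) :
    remainder M a (-(x : ℂ)) = (((Complex.exp (-X - Complex.I * omega a * X)
      * Complex.exp (-(Complex.I * ν * omega a))
      * ∫ u : ℝ, (Real.exp (-(X / 2 * u ^ 2)) : ℂ) * f a ν u).im / Real.pi : ℝ) : ℂ) := by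
  have hx0 : 0 < x := hx ▸ Real.rpow_pos_of_pos hX a
  have himg : (fun u => Real.log X + saddleLog u) '' univ = univ := by
    rw [image_univ, range_eq_univ]
    intro r
    exact ⟨saddleU (Real.exp (r - Real.log X)), by
      simp only; rw [saddleLog_saddleU_exp]; ring⟩
  have hinj : InjOn (fun u => Real.log X + saddleLog u) univ := by
    intro u _ v _ h
    have h1 : saddleLog u = saddleLog v := add_left_cancel h
    rw [← saddleU_exp_saddleLog u, h1, saddleU_exp_saddleLog]
  have h := integral_image_eq_integral_abs_deriv_smul (s := univ) MeasurableSet.univ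
    (fun u _ => ((hasDerivAt_saddleLog u).1.const_add (Real.log X)).hasDerivWithinAt) hinj
    (fun r : ℝ => remainderKernel M a x (r + Real.pi * Complex.I))
  rw [himg, setIntegral_univ, setIntegral_univ] at h
  have h2 : ((-x : ℝ) : ℂ) ^ (-(M : ℤ)) * ∫ r : ℝ, remainderKernel M a x (r + Real.pi * Complex.I)
      = Complex.exp (-X - Complex.I * omega a * X) * Complex.exp (-(Complex.I * ν * omega a))
        * ∫ u : ℝ, (Real.exp (-(X / 2 * u ^ 2)) : ℂ) * f a ν u := by
    rw [h, ← integral_const_mul, ← integral_const_mul]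
    congr 1 with u
    rw [abs_of_pos (hasDerivAt_saddleLog u).2.1, Complex.real_smul, Complex.ofReal_neg]
    exact zpow_neg_mul_remainderKernel ha ha1 hX hx hM u
  rw [remainder_eq_im_integral M ha ha1 hx0, ← h2, ← Complex.ofReal_zpow, Complex.im_ofReal_mul]
  congr 1
  ring

theorem integral_gaussian_mul_f {a ν X : ℝ} (ha : 1 / 3 < a) (ha1 : a < 1) (hX : 0 < X)
    (hg : Integrable fun u : ℝ => (Real.exp (-(X / 2 * u ^ 2)) : ℂ) * g a ν u) :
    ∫ u : ℝ, (Real.exp (-(X / 2 * u ^ 2)) : ℂ) * f a ν u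
      = residueA a ν * (Complex.I * Real.pi * Complex.exp (X * cRoot (omega a) ^ 2 / 2)
          * erfc (cRoot (omega a) * (Real.sqrt (X / 2) : ℝ))
        + ∫ u : ℝ, (Real.exp (-(X / 2 * u ^ 2)) : ℂ) * g a ν u) := by
  have hc := re_cRoot_omega_pos ha ha1
  have hp := integral_gaussian_div_sub_scaled hc hX
  have hw := integrable_pow_mul_gaussian (half_pos hX) 0
  simp only [pow_zero, mul_one] at hw
  have hpi : Integrable fun u : ℝ => (Real.exp (-(X / 2 * u ^ 2)) : ℂ) * (1 / (u - poleU a)) := by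
    refine (hw.mul_const (1 / (cRoot (omega a)).re)).mono' ?_ (Eventually.of_forall fun u => ?_)
    · exact Measurable.aestronglyMeasurable (by fun_prop)
    · rw [norm_mul, Complex.norm_real, Real.norm_of_nonneg (Real.exp_pos _).le]
      gcongr
      exact norm_one_div_sub_poleU_le ha ha1 u
  have hp' : ∫ u : ℝ, (Real.exp (-(X / 2 * u ^ 2)) : ℂ) * (1 / (u - poleU a))
      = Complex.I * Real.pi * Complex.exp (X * cRoot (omega a) ^ 2 / 2)
          * erfc (cRoot (omega a) * (Real.sqrt (X / 2) : ℝ)) := by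
    rw [← hp, poleU]
    congr 1 with u
    rw [div_mul_eq_mul_div]
  rw [← hp', ← integral_add hpi hg, ← integral_const_mul]
  congr 1 with u
  rw [f_eq_residueA_mul (by linarith)]
  ring

theorem integrable_gaussian_mul {h : ℝ → ℂ} {C β X : ℝ} (hm : AEStronglyMeasurable h)
    (hb : ∀ u, ‖h u‖ ≤ C * Real.exp (β * u ^ 2)) (hX0 : 0 < X) (hX : 4 * β ≤ X) :
    Integrable (fun u : ℝ => (Real.exp (-(X / 2 * u ^ 2)) : ℂ) * h u) ∧
    ‖∫ u : ℝ, (Real.exp (-(X / 2 * u ^ 2)) : ℂ) * h u‖ ≤ C * Real.sqrt (Real.pi / (X / 4)) := by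
  have hw := integrable_exp_neg_mul_sq (b := X / 4) (by positivity)
  have hC : 0 ≤ C := nonneg_of_mul_nonneg_left ((norm_nonneg _).trans (hb 0)) (Real.exp_pos _)
  have hle : ∀ u : ℝ, ‖(Real.exp (-(X / 2 * u ^ 2)) : ℂ) * h u‖
      ≤ C * Real.exp (-(X / 4) * u ^ 2) := by
    intro u
    rw [norm_mul, Complex.norm_real, Real.norm_of_nonneg (Real.exp_pos _).le]
    calc _ ≤ Real.exp (-(X / 2 * u ^ 2)) * (C * Real.exp (β * u ^ 2)) := by gcongr; exact hb u
      _ = C * Real.exp (-(X / 2 * u ^ 2) + β * u ^ 2) := by rw [Real.exp_add]; ring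
      _ ≤ _ := by gcongr; nlinarith [sq_nonneg u]
  refine ⟨(hw.const_mul C).mono' (AEStronglyMeasurable.mul
    (Continuous.aestronglyMeasurable (by fun_prop)) hm) (Eventually.of_forall hle), ?_⟩
  refine (norm_integral_le_of_norm_le (hw.const_mul C) (Eventually.of_forall hle)).trans_eq ?_
  rw [integral_const_mul, integral_gaussian]

theorem norm_exp_neg_sub (w X : ℝ) :
    ‖Complex.exp (-X - Complex.I * w * X)‖ = Real.exp (-X) := by
  rw [Complex.norm_exp]; simp

theorem remainder_bound {a : ℝ} (ha : 0 < a) (ha1 : a < 1) (N : ℝ) : ∃ C X₀ : ℝ,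
    ∀ (x X ν : ℝ) (M : ℕ), X₀ ≤ X → x = X ^ a → a * M = X + ν → |ν| ≤ N →
      ‖remainder M a (-(x : ℂ))‖ ≤ C * Real.exp (-X) := by
  refine ⟨8 * Real.exp N / Real.sin (a * Real.pi) * Real.sqrt (Real.pi / (1 / 4)) / Real.pi,
    max 1 (4 * (N / 2 + 1)), fun x X ν M hX hx hM hν => ?_⟩
  have hX1 : 1 ≤ X := (le_max_left _ _).trans hX
  have hs := sin_mul_pi_pos ha ha1
  have hpi := Real.pi_pos
  have h := (integrable_gaussian_mul (measurable_f a ν).aestronglyMeasurable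
    (fun u => norm_f_le ha ha1 hν u) (by linarith) ((le_max_right _ _).trans hX)).2
  rw [remainder_eq_im ha ha1 (by linarith) hx hM, Complex.norm_real, Real.norm_eq_abs, abs_div,
    abs_of_pos hpi, div_mul_eq_mul_div]
  gcongr
  refine (Complex.abs_im_le_norm _).trans ?_
  have h2 : ‖Complex.exp (-(Complex.I * ν * omega a))‖ = 1 := by
    rw [Complex.norm_exp]; simp
  rw [norm_mul, norm_mul, h2, mul_one, norm_exp_neg_sub, mul_comm]
  gcongr
  refine h.trans ?_
  gcongr

theorem expansion_bound {a : ℝ} (ha : 1 / 3 < a) (ha1 : a < 1) (N : ℝ) (K : ℕ) : ∃ C X₀ : ℝ,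
    ∀ (x X ν : ℝ) (M : ℕ), X₀ ≤ X → x = X ^ a → a * M = X + ν → |ν| ≤ N →
      ‖remainder M a (-(x : ℂ)) - ((2 / a * (expansion a ν X K).re : ℝ) : ℂ)‖
        ≤ C * (Real.exp (-X) * X ^ (-(K : ℝ) - 1 / 2)) := by
  have ha0 : 0 < a := by linarith
  have hpi := Real.pi_pos
  obtain ⟨ρ, hρ, hsum, hcoef⟩ := exists_hasSum_coeffB ha ha1
  obtain ⟨B, hB0, hB⟩ := hcoef N
  obtain ⟨C, hC0, hC⟩ := exists_norm_g_le ha ha1 N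
  set T := (2 * B + (C + (2 * K : ℕ) * B) * 2 ^ (2 * K)) / ρ ^ (2 * K) with hT
  refine ⟨1 / (Real.pi * a) * (T * ((1 / 4) ^ (-((K : ℝ) + 1 / 2)) * Real.Gamma (K + 1 / 2))),
    max 1 (4 * (N / 2 + 1)), fun x X ν M hX hx hM hν => ?_⟩
  have hX1 : 1 ≤ X := (le_max_left _ _).trans hX
  have hX0 : 0 < X := by linarith
  have hXβ : 4 * (N / 2 + 1) ≤ X := (le_max_right _ _).trans hX
  have hN : 0 ≤ N := (abs_nonneg _).trans hν
  have hgm := (measurable_g a ν).aestronglyMeasurable (μ := volume)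
  have hgi := (integrable_gaussian_mul hgm (hC ν hν) hX0 hXβ).1
  have hW := norm_integral_gaussian_sub_le (B := coeffB a ν) K hgm (fun u => by
    have := norm_sub_taylor_le hρ hB0 hC0 (by positivity) (hB ν hν) (hsum ν) (hC ν hν) (2 * K) u
    rwa [(even_two_mul K).pow_abs] at this) hX0 hXβ
  simp only [integral_gaussian_moment hX0] at hW
  set J := ∫ u : ℝ, (Real.exp (-(X / 2 * u ^ 2)) : ℂ) * g a ν u with hJ
  set S := ∑ k ∈ Finset.range K, coeffB a ν (2 * k) * (2 * Real.pi / (Real.sqrt (2 * Real.pi * X) : ℝ)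
    * ((ascPochhammer ℂ k).eval (1 / 2) * ((X : ℂ) / 2) ^ (-(k : ℤ)))) with hS
  have key : remainder M a (-(x : ℂ)) - ((2 / a * (expansion a ν X K).re : ℝ) : ℂ)
      = ((1 / (Real.pi * a) * (Complex.exp (-X - Complex.I * omega a * X) * (J - S)).im : ℝ) : ℂ) := by
    rw [remainder_eq_im ha0 ha1 hX0 hx hM, integral_gaussian_mul_f ha ha1 hX0 hgi, ← hJ,
      ← Complex.ofReal_sub]
    congr 1
    set e := Complex.exp (-X - Complex.I * omega a * X) with he
    set E := erfc (cRoot (omega a) * (Real.sqrt (X / 2) : ℝ)) with hE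
    have h1 : Complex.exp (X * Complex.exp (Real.pi * Complex.I / a))
        = e * Complex.exp (X * cRoot (omega a) ^ 2 / 2) := by
      have h2 : Complex.exp (Real.pi * Complex.I / a) = -Complex.exp (Complex.I * omega a) := by
        have : Real.pi * Complex.I / a = Real.pi * Complex.I + Complex.I * omega a := by
          have ha' : (a : ℂ) ≠ 0 := by exact_mod_cast ha0.ne'
          rw [omega]; push_cast; field_simp; ring
        rw [this, Complex.exp_add, Complex.exp_pi_mul_I, neg_one_mul]
      rw [h2, he, ← Complex.exp_add]
      congr 1
      linear_combination -X * cRoot_sq (omega a)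
    have h3 : Complex.exp (-(Complex.I * ν * omega a)) * residueA a ν = ((1 / a : ℝ) : ℂ) := by
      rw [residueA, mul_div_assoc', ← Complex.exp_add]
      simp
    have h4 : S = ((2 * Real.pi / Real.sqrt (2 * Real.pi * X) : ℝ) : ℂ) * ∑ k ∈ Finset.range K,
        coeffB a ν (2 * k) * (ascPochhammer ℂ k).eval (1 / 2) * ((X : ℂ) / 2) ^ (-(k : ℤ)) := by
      rw [hS, Finset.mul_sum]
      refine Finset.sum_congr rfl fun k _ => ?_
      push_cast; ring
    set Z := ∑ k ∈ Finset.range K,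
        coeffB a ν (2 * k) * (ascPochhammer ℂ k).eval (1 / 2) * ((X : ℂ) / 2) ^ (-(k : ℤ)) with hZ
    have h5 : e * Complex.exp (-(Complex.I * ν * omega a)) * (residueA a ν *
        (Complex.I * Real.pi * Complex.exp (X * cRoot (omega a) ^ 2 / 2) * E + J))
        = ((1 / a : ℝ) : ℂ) * (Complex.I * (((Real.pi : ℝ) : ℂ)
          * (Complex.exp (X * Complex.exp (Real.pi * Complex.I / a)) * E)) + e * J) := by
      rw [h1, ← h3]; ring
    have h6 : expansion a ν X K = ((1 / 2 : ℝ) : ℂ)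
        * (Complex.exp (X * Complex.exp (Real.pi * Complex.I / a)) * E)
        - ((1 / Real.sqrt (2 * Real.pi * X) : ℝ) : ℂ) * (Complex.I * (e * Z)) := by
      rw [expansion, ← hE, ← hZ, ← he]
      push_cast
      ring
    have h7 : e * (J - S) = e * J - ((2 * Real.pi / Real.sqrt (2 * Real.pi * X) : ℝ) : ℂ) * (e * Z) := by
      rw [h4]; ring
    rw [h5, h6, h7]
    simp only [Complex.im_ofReal_mul, Complex.add_im, Complex.sub_re, Complex.sub_im,
      Complex.re_ofReal_mul, Complex.I_mul_re, Complex.I_mul_im]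
    field_simp
    ring
  rw [key, Complex.norm_real, norm_mul, Real.norm_of_nonneg (by positivity), Real.norm_eq_abs,
    mul_assoc (1 / (Real.pi * a))]
  refine mul_le_mul_of_nonneg_left ((Complex.abs_im_le_norm _).trans ?_) (by positivity)
  rw [norm_mul, norm_exp_neg_sub]
  calc _ ≤ Real.exp (-X) * (T * ((X / 4) ^ (-((K : ℝ) + 1 / 2)) * Real.Gamma (K + 1 / 2))) := by
        gcongr
    _ = _ := by
      rw [show X / 4 = X * (1 / 4) by ring, Real.mul_rpow hX0.le (by norm_num), neg_add']
      ring

end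

end MittagLefflerExpansion

open MittagLefflerExpansion in
theorem theorem1 (a : ℝ) (ha : 1 / 3 < a) (ha1 : a < 1) :
    -- the Mittag-Leffler series converge everywhere
    (∀ (b : ℝ) (z : ℂ), Summable (mlTerm a b z)) ∧
    -- algebraic sum plus remainder
    (∀ (x : ℝ) (M : ℕ), 0 < x →
      mittagLeffler a (-(x : ℂ)) =
        -∑ k ∈ Finset.Icc 1 M,
            (-(x : ℂ)) ^ (-(k : ℤ)) / Complex.Gamma ((1 - a * k : ℝ) : ℂ)
          + remainder M a (-(x : ℂ))) ∧
    -- the quantity `c(π)` and its expansion for small `ω`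
    (cRoot (omega a) ^ 2 / 2 =
      1 + Complex.I * omega a - Complex.exp (Complex.I * omega a)) ∧
    ((fun ω : ℝ => cRoot ω
        - ((ω : ℂ) + Complex.I / 6 * ω ^ 2 - 1 / 36 * ω ^ 3
            - Complex.I / 270 * ω ^ 4 + 1 / 2592 * ω ^ 5))
      =O[𝓝 0] fun ω : ℝ => ω ^ 6) ∧
    -- the coefficients: expansion of `f` about the saddle with the pole part split off
    (∀ ν : ℝ, ∀ᶠ u : ℝ in 𝓝 0, ∃ s : ℂ,
      HasSum (fun r : ℕ => coeffB a ν r * (u : ℂ) ^ r) s ∧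
      f a ν u = residueA a ν * (1 / ((u : ℂ) - poleU a) + s)) ∧
    -- the remainder is exponentially small when `a M = X + ν` with `X = x ^ (1 / a)`, `|ν| ≤ N`
    (∀ N : ℝ, ∃ C : ℝ, ∀ᶠ x : ℝ in atTop, ∀ M : ℕ, |a * M - x ^ (1 / a)| ≤ N →
      ‖remainder M a (-(x : ℂ))‖ ≤ C * Real.exp (-x ^ (1 / a))) ∧
    -- its asymptotic expansion to every order `K`, uniformly for `|ν| ≤ N`
    (∀ (N : ℝ) (K : ℕ), ∃ C : ℝ, ∀ᶠ x : ℝ in atTop, ∀ (M : ℕ) (ν X : ℝ),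
      X = x ^ (1 / a) → a * M = X + ν → |ν| ≤ N →
      ‖remainder M a (-(x : ℂ)) - ((2 / a * (expansion a ν X K).re : ℝ) : ℂ)‖
        ≤ C * (Real.exp (-X) * X ^ (-(K : ℝ) - 1 / 2))) := by
  have ha0 : 0 < a := by linarith
  have hlarge : ∀ X₀ : ℝ, ∀ᶠ x : ℝ in atTop, X₀ ≤ x ^ (1 / a) ∧ x = (x ^ (1 / a)) ^ a := by
    intro X₀
    filter_upwards [(tendsto_rpow_atTop (one_div_pos.2 ha0)).eventually_ge_atTop X₀,
      eventually_ge_atTop 0] with x hx hx0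
    refine ⟨hx, ?_⟩
    rw [← Real.rpow_mul hx0, one_div_mul_cancel ha0.ne', Real.rpow_one]
  refine ⟨summable_mlTerm ha0, fun x M hx => mittagLeffler_eq_neg_sum_add_remainder ha0 hx.ne' M,
    cRoot_sq _, cRoot_sub_taylor_isBigO, fun ν => ?_, fun N => ?_, fun N K => ?_⟩
  · obtain ⟨ρ, hρ, hsum, -⟩ := exists_hasSum_coeffB ha ha1
    filter_upwards [(isOpen_lt continuous_abs continuous_const).mem_nhds
      (show |(0 : ℝ)| < ρ by simpa using hρ)] with u hu
    exact ⟨g a ν u, hsum ν u hu, f_eq_residueA_mul ha0.ne' ν u⟩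
  · obtain ⟨C, X₀, h⟩ := remainder_bound ha0 ha1 N
    refine ⟨C, ?_⟩
    filter_upwards [hlarge X₀] with x hx M hM
    exact h x _ _ M hx.1 hx.2 (by ring) hM
  · obtain ⟨C, X₀, h⟩ := expansion_bound ha ha1 N K
    refine ⟨C, ?_⟩
    filter_upwards [hlarge X₀] with x hx M ν X hX hM hν
    subst hX
    exact h x _ ν M hx.1 hx.2 hM hν
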